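/- All lattices are distributive, bounded (with least element $0$ and greatest element $1$) and separative, i.e. whenever $a\not\le b$ there is $c\neq 0$ with $c\le a$ and $c\wedge b=0$. For a lattice $L$, the Wallman space $wL$ is the set of all ultrafilters (maximal proper filters) on $L$, with the topology in which the sets $\widehat a=\{u\in wL: a\in u\}$, $a\in L$, form a base for the closed sets. For $m\ge 2$ a space $X$ is an $m$-$C$-space if for each sequence $\mathcal U_1,\mathcal U_2,\dots$ of $m$-element open covers of $X$ there is a sequence $\mathcal V_1,\mathcal V_2,\dots$ such that each $\mathcal V_i$ is a family of pairwise disjoint open subsets of $X$, each member of $\mathcal V_i$ is contained in some member of $\mathcal U_i$, and $\bigcup_{i=1}^\infty\mathcal V_i$ covers $X$. For a cardinal $\kappa$ let $H(\kappa)$ be the set of all sets whose transitive closure has cardinality less than $\kappa$. **Proposition.** Let $\kappa$ be an uncountable regular cardinal and let $\mathcal M\prec H(\kappa)$ be an elementary submodel (with respect to the membership relation). Let $K^*$ be a lattice in $\mathcal M$ (that is, the tuple $(K^*,\vee,\wedge,0,1)$ is an element of $\mathcal M$), and let $K=K^*\cap\mathcal M$, a sublattice of $K^*$ containing $0$ and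 $1$. Then for each $m\ge 2$, $wK^*$ is an $m$-$C$-space if and only if $wK$ is an $m$-$C$-space. -/

import Mathlib

open scoped Cardinal

universe u

namespace MC

/-! ### Topology: `m`-`C`-spaces -/

/-- `X` is an `m`-`C`-space: for each sequence of `m`-element open covers `𝒰 i` of `X` there are
families `𝒱 i` of pairwise disjoint open sets, `𝒱 i` refining `𝒰 i`, whose union covers `X`. -/
def IsMCSpace (m : ℕ) (X : Type*) [TopologicalSpace X] : Prop :=
  ∀ 𝒰 : ℕ → Set (Set X),
    (∀ i, (𝒰 i).encard = m ∧ (∀ U ∈ 𝒰 i, IsOpen U) ∧ ⋃₀ 𝒰 i = Set.univ) →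
    ∃ 𝒱 : ℕ → Set (Set X),
      (∀ i, (∀ V ∈ 𝒱 i, IsOpen V) ∧ (𝒱 i).PairwiseDisjoint id ∧
        ∀ V ∈ 𝒱 i, ∃ U ∈ 𝒰 i, V ⊆ U) ∧
      ⋃ i, ⋃₀ 𝒱 i = Set.univ

/-! ### Lattices and Wallman spaces -/

/-- A lattice is separative if whenever `a ≰ b`, some nonzero `c ≤ a` is disjoint from `b`. -/
def IsSeparative (L : Type*) [Lattice L] [BoundedOrder L] : Prop :=
  ∀ a b : L, ¬ a ≤ b → ∃ c : L, c ≠ ⊥ ∧ c ≤ a ∧ c ⊓ b = ⊥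

/-- Proper filters on a bounded lattice. -/
structure IsProperFilter {L : Type*} [Lattice L] [BoundedOrder L] (F : Set L) : Prop where
  top_mem : ⊤ ∈ F
  bot_notMem : ⊥ ∉ F
  inf_mem : ∀ a ∈ F, ∀ b ∈ F, a ⊓ b ∈ F
  mem_of_le : ∀ a ∈ F, ∀ b, a ≤ b → b ∈ F

/-- The Wallman space `wL`: the set of ultrafilters (maximal proper filters) on `L`. -/
def Wallman (L : Type*) [Lattice L] [BoundedOrder L] : Type _ :=
  {F : Set L // Maximal IsProperFilter F}

/-- The basic closed set `â`, the set of all ultrafilters that contain `a`. -/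
def Wallman.hat {L : Type*} [Lattice L] [BoundedOrder L] (a : L) : Set (Wallman L) :=
  {u | a ∈ u.1}

/-- The topology on `wL` in which the sets `â` form a base for the closed sets. -/
instance Wallman.instTopologicalSpace (L : Type*) [Lattice L] [BoundedOrder L] :
    TopologicalSpace (Wallman L) :=
  TopologicalSpace.generateFrom {U | ∃ a : L, U = (Wallman.hat a)ᶜ}

/-! ### The sets `H(κ)` and their elementary submodels -/

/-- The transitive closure `x ∪ ⋃x ∪ ⋃⋃x ∪ …`. -/
def transClosure (x : ZFSet.{u}) : Set ZFSet.{u} :=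
  {y | ∃ n : ℕ, y ∈ (ZFSet.sUnion^[n]) x}

/-- `H(κ)`, the class of all sets whose transitive closure has fewer than `κ` elements. -/
def H (κ : Cardinal.{u}) : Set ZFSet.{u} :=
  {x | #(transClosure x) < Cardinal.lift.{u + 1} κ}

/-- The only symbol of the language of set theory. -/
inductive SetRel : ℕ → Type
  | mem : SetRel 2

/-- The first-order language of set theory, with one binary relation symbol. -/
def setLang : FirstOrder.Language := ⟨fun _ => Empty, SetRel⟩

/-- The membership symbol. -/
abbrev memRel : setLang.Relations 2 := SetRel.mem

/-- A class `N` of sets as the first-order structure `(N, ∈)`. -/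
instance setStructure (N : Set ZFSet.{u}) : setLang.Structure N where
  funMap := fun f _ => nomatch f
  RelMap := fun r x => match r with
    | .mem => (x 0).1 ∈ (x 1).1

/-- `M ≺ N`: `(M, ∈)` is an elementary submodel of `(N, ∈)`. -/
def IsElemSubmodel (M N : Set ZFSet.{u}) : Prop :=
  ∃ S : setLang.ElementarySubstructure N, Subtype.val '' (S : Set N) = M

/-! ### Lattices as sets -/

/-- The type of elements of the set `A`. -/
def Elem (A : ZFSet.{u}) : Type (u + 1) := {x : ZFSet.{u} // x ∈ A}

/-- The graph of a binary operation on `A`, as a set of ordered pairs `((a, b), f a b)`. -/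
noncomputable def opGraph (A : ZFSet.{u}) (f : Elem A → Elem A → Elem A) : ZFSet.{u} :=
  ZFSet.sep (fun p => ∃ a b : Elem A, p = ZFSet.pair (ZFSet.pair a.1 b.1) (f a b).1)
    ((A.prod A).prod A)

/-- A lattice with underlying set `A`, as the tuple `(A, ⊔, ⊓, 0, 1)`. -/
noncomputable def latticeCode (A : ZFSet.{u}) [Lattice (Elem A)] [BoundedOrder (Elem A)] :
    ZFSet.{u} :=
  ZFSet.pair A (ZFSet.pair (opGraph A (· ⊔ ·)) (ZFSet.pair (opGraph A (· ⊓ ·))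
    (ZFSet.pair (⊥ : Elem A).1 (⊤ : Elem A).1)))

/-! ### The trace of a lattice on an elementary submodel is a sublattice -/

theorem mem_H_of_mem {κ : Cardinal.{u}} {x y : ZFSet.{u}} (hx : x ∈ H κ) (hy : y ∈ x) :
    y ∈ H κ := by
  have mono : ∀ n : ℕ, ∀ s t : ZFSet.{u}, s ⊆ t →
      (ZFSet.sUnion^[n]) s ⊆ (ZFSet.sUnion^[n]) t := by
    intro n
    induction n with
    | zero => intro s t h; exact h
    | succ n ih =>
      intro s t h
      rw [Function.iterate_succ_apply, Function.iterate_succ_apply]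
      apply ih
      intro z hz
      obtain ⟨w, hw, hzw⟩ := ZFSet.mem_sUnion.1 hz
      exact ZFSet.mem_sUnion.2 ⟨w, h hw, hzw⟩
  have hsub : transClosure y ⊆ transClosure x := by
    rintro z ⟨n, hz⟩
    refine ⟨n + 1, ?_⟩
    rw [Function.iterate_succ_apply]
    exact mono n _ _ (fun w hw => ZFSet.mem_sUnion.2 ⟨y, hy, hw⟩) hz
  exact lt_of_le_of_lt (Cardinal.mk_le_mk_of_subset hsub) hx

section Trace

open FirstOrder FirstOrder.Language

theorem exists_realize {N : Set ZFSet.{u}} (S : setLang.ElementarySubstructure N)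
    (φ : setLang.BoundedFormula (Fin 2) 1) (a b : N) (ha : a ∈ S) (hb : b ∈ S)
    (h : ∃ w : N, φ.Realize ![a, b] ![w]) : ∃ w ∈ S, φ.Realize ![a, b] ![w] := by
  have key := S.subtype.map_formula φ.ex ![⟨a, ha⟩, ⟨b, hb⟩]
  have e : (S.subtype ∘ ![⟨a, ha⟩, ⟨b, hb⟩] : Fin 2 → N) = ![a, b] := by
    ext i; fin_cases i <;> rfl
  rw [e] at key
  have h1 : Formula.Realize (M := N) φ.ex ![a, b] := by
    obtain ⟨w, hw⟩ := h
    refine BoundedFormula.realize_ex.2 ⟨w, ?_⟩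
    convert hw using 1
    ext i; fin_cases i; rfl
  obtain ⟨w, hw⟩ := BoundedFormula.realize_ex.1 (key.1 h1)
  refine ⟨w.1, w.2, ?_⟩
  have := (S.subtype.map_boundedFormula φ _ _).2 hw
  rw [e] at this
  convert this using 1
  ext i; fin_cases i; rfl

/-- The formula `s ∈ t`. -/
def memF {n : ℕ} (s t : setLang.Term (Fin 2 ⊕ Fin n)) : setLang.BoundedFormula (Fin 2) n :=
  Relations.boundedFormula₂ memRel s t

theorem realize_memF {N : Set ZFSet.{u}} {n : ℕ} (s t : setLang.Term (Fin 2 ⊕ Fin n))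
    (v : Fin 2 → N) (xs : Fin n → N) :
    (memF s t).Realize v xs ↔
      (s.realize (Sum.elim v xs)).1 ∈ (t.realize (Sum.elim v xs)).1 := by
  unfold memF
  rw [BoundedFormula.realize_rel₂]
  rfl

variable {κ : Cardinal.{u}} {M : Set ZFSet.{u}}

theorem IsElemSubmodel.sub {N : Set ZFSet.{u}} (h : IsElemSubmodel M N) : M ⊆ N := by
  obtain ⟨S, rfl⟩ := h
  rintro _ ⟨x, -, rfl⟩
  exact x.2

/-- If the set `z ∈ M` has an element other than `x ∈ M`, then it has such an element in `M`. -/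
theorem IsElemSubmodel.exists_ne (h : IsElemSubmodel M (H κ)) {z x : ZFSet.{u}} (hz : z ∈ M)
    (hx : x ∈ M) (hw : ∃ w ∈ z, w ≠ x) : ∃ w ∈ M, w ∈ z ∧ w ≠ x := by
  have hsub := h.sub
  obtain ⟨S, rfl⟩ := h
  obtain ⟨z, hz, rfl⟩ := hz
  obtain ⟨x, hx, rfl⟩ := hx
  obtain ⟨w, hwz, hwx⟩ := hw
  obtain ⟨w', hw', hr⟩ := exists_realize S
    (memF (&0) (Term.var (Sum.inl 0)) ⊓ ∼((&0) =' (Term.var (Sum.inl 1)))) z x hz hx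
    ⟨⟨w, mem_H_of_mem z.2 hwz⟩, by
      simp [realize_memF, BoundedFormula.realize_bdEqual, hwz, Subtype.ext_iff, hwx]⟩
  simp [realize_memF, BoundedFormula.realize_bdEqual, Subtype.ext_iff] at hr
  exact ⟨w', ⟨w', hw', rfl⟩, hr.1, hr.2⟩

/-- If the set `s ∈ M` has an element that contains `t ∈ M`, then it has such an element
in `M`. -/
theorem IsElemSubmodel.exists_mem (h : IsElemSubmodel M (H κ)) {s t : ZFSet.{u}} (hs : s ∈ M)
    (ht : t ∈ M) (hw : ∃ w ∈ s, t ∈ w) : ∃ w ∈ M, w ∈ s ∧ t ∈ w := by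
  obtain ⟨S, rfl⟩ := h
  obtain ⟨s, hs, rfl⟩ := hs
  obtain ⟨t, ht, rfl⟩ := ht
  obtain ⟨w, hws, hwt⟩ := hw
  obtain ⟨w', hw', hr⟩ := exists_realize S
    (memF (&0) (Term.var (Sum.inl 0)) ⊓ memF (Term.var (Sum.inl 1)) (&0)) s t hs ht
    ⟨⟨w, mem_H_of_mem s.2 hws⟩, by simp [realize_memF, hws, hwt]⟩
  simp [realize_memF] at hr
  exact ⟨w', ⟨w', hw', rfl⟩, hr.1, hr.2⟩

theorem IsElemSubmodel.upair_mem (h : IsElemSubmodel M (H κ)) {a b : ZFSet.{u}} (ha : a ∈ M)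
    (hb : b ∈ M) (hab : ({a, b} : ZFSet.{u}) ∈ H κ) : ({a, b} : ZFSet.{u}) ∈ M := by
  obtain ⟨S, rfl⟩ := h
  obtain ⟨a, ha, rfl⟩ := ha
  obtain ⟨b, hb, rfl⟩ := hb
  obtain ⟨w, hw, hr⟩ := exists_realize S
    (∀' ((memF (&1) (&0)).iff
      (((&1) =' (Term.var (Sum.inl 0))) ⊔ ((&1) =' (Term.var (Sum.inl 1)))))) a b ha hb
    ⟨⟨{a.1, b.1}, hab⟩, by
      simp [realize_memF, BoundedFormula.realize_bdEqual, Subtype.ext_iff]⟩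
  simp [realize_memF, BoundedFormula.realize_bdEqual, Subtype.ext_iff] at hr
  refine ⟨w, hw, ?_⟩
  ext x
  rw [ZFSet.mem_pair]
  constructor
  · intro hx
    exact (hr x (mem_H_of_mem w.2 hx)).1 hx
  · rintro (rfl | rfl)
    · exact (hr _ a.2).2 (Or.inl rfl)
    · exact (hr _ b.2).2 (Or.inr rfl)

theorem IsElemSubmodel.of_upair_mem (h : IsElemSubmodel M (H κ)) {x y : ZFSet.{u}}
    (hz : ({x, y} : ZFSet.{u}) ∈ M) : x ∈ M ∧ y ∈ M := by
  have hx : x ∈ ({x, y} : ZFSet.{u}) := ZFSet.mem_pair.2 (Or.inl rfl)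
  obtain ⟨w, hw, hwz, -⟩ := h.exists_ne hz hz
    ⟨x, hx, fun e => ZFSet.mem_irrefl x (by rw [← e] at hx; exact hx)⟩
  by_cases hxy : x = y
  · subst hxy
    rcases ZFSet.mem_pair.1 hwz with rfl | rfl <;> exact ⟨hw, hw⟩
  · rcases ZFSet.mem_pair.1 hwz with rfl | rfl
    · obtain ⟨v, hv, hvz, hne⟩ := h.exists_ne hz hw ⟨y, by simp, Ne.symm hxy⟩
      rcases ZFSet.mem_pair.1 hvz with rfl | rfl
      · exact absurd rfl hne
      · exact ⟨hw, hv⟩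
    · obtain ⟨v, hv, hvz, hne⟩ := h.exists_ne hz hw ⟨x, by simp, hxy⟩
      rcases ZFSet.mem_pair.1 hvz with rfl | rfl
      · exact ⟨hv, hw⟩
      · exact absurd rfl hne

theorem IsElemSubmodel.of_pair_mem (h : IsElemSubmodel M (H κ)) {x y : ZFSet.{u}}
    (hz : ZFSet.pair x y ∈ M) : x ∈ M ∧ y ∈ M :=
  h.of_upair_mem (h.of_upair_mem hz).2

theorem mem_opGraph {A : ZFSet.{u}} {f : Elem A → Elem A → Elem A} {p : ZFSet.{u}} :
    p ∈ opGraph A f ↔ ∃ a b : Elem A, p = ZFSet.pair (ZFSet.pair a.1 b.1) (f a b).1 := by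
  unfold opGraph
  rw [ZFSet.mem_sep]
  refine ⟨fun h => h.2, fun h => ⟨?_, h⟩⟩
  obtain ⟨a, b, rfl⟩ := h
  exact ZFSet.pair_mem_prod.2 ⟨ZFSet.pair_mem_prod.2 ⟨a.2, b.2⟩, (f a b).2⟩

theorem IsElemSubmodel.op_mem (h : IsElemSubmodel M (H κ)) {A : ZFSet.{u}}
    {f : Elem A → Elem A → Elem A} (hf : opGraph A f ∈ M) {a b : Elem A} (ha : a.1 ∈ M)
    (hb : b.1 ∈ M) : (f a b).1 ∈ M := by
  have hp : ZFSet.pair (ZFSet.pair a.1 b.1) (f a b).1 ∈ opGraph A f := mem_opGraph.2 ⟨a, b, rfl⟩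
  have hpH := mem_H_of_mem (h.sub hf) hp
  have hq1H : ({ZFSet.pair a.1 b.1} : ZFSet.{u}) ∈ H κ :=
    mem_H_of_mem hpH (by simp [ZFSet.pair])
  have hqH : ZFSet.pair a.1 b.1 ∈ H κ := mem_H_of_mem hq1H (by simp)
  have h1 : ({a.1} : ZFSet.{u}) ∈ M := by
    have : ({a.1} : ZFSet.{u}) ∈ H κ := mem_H_of_mem hqH (by simp [ZFSet.pair])
    rw [← ZFSet.pair_eq_singleton] at this ⊢
    exact h.upair_mem ha ha this
  have h2 : ({a.1, b.1} : ZFSet.{u}) ∈ M :=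
    h.upair_mem ha hb (mem_H_of_mem hqH (by simp [ZFSet.pair]))
  have hq : ZFSet.pair a.1 b.1 ∈ M := h.upair_mem h1 h2 hqH
  have hq1 : ({ZFSet.pair a.1 b.1} : ZFSet.{u}) ∈ M := by
    rw [← ZFSet.pair_eq_singleton] at hq1H ⊢
    exact h.upair_mem hq hq hq1H
  obtain ⟨p, hpM, hpf, hqp⟩ := h.exists_mem hf hq1 ⟨_, hp, by simp [ZFSet.pair]⟩
  obtain ⟨a', b', rfl⟩ := mem_opGraph.1 hpf
  have hab : ZFSet.pair a.1 b.1 = ZFSet.pair a'.1 b'.1 := by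
    rcases ZFSet.mem_pair.1 hqp with e | e
    · exact ZFSet.singleton_injective e
    · exact (ZFSet.singleton_eq_pair_iff.1 e).1
  obtain ⟨ea, eb⟩ := ZFSet.pair_inj.1 hab
  obtain rfl : a = a' := Subtype.ext ea
  obtain rfl : b = b' := Subtype.ext eb
  exact (h.of_pair_mem hpM).2

/-- The sublattice `K = K* ∩ M` of a lattice `K*` that belongs to `M ≺ H(κ)`. -/
def traceLattice (A : ZFSet.{u}) [Lattice (Elem A)] [BoundedOrder (Elem A)]
    (hM : IsElemSubmodel M (H κ)) (hA : latticeCode A ∈ M) : Sublattice (Elem A) where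
  carrier := {a | a.1 ∈ M}
  supClosed' := fun _ ha _ hb =>
    hM.op_mem (hM.of_pair_mem (hM.of_pair_mem hA).2).1 ha hb
  infClosed' := fun _ ha _ hb =>
    hM.op_mem (hM.of_pair_mem (hM.of_pair_mem (hM.of_pair_mem hA).2).2).1 ha hb

/-- `K* ∩ M` has the same least and greatest elements as `K*`. -/
instance traceLattice.instBoundedOrder (A : ZFSet.{u}) [Lattice (Elem A)]
    [BoundedOrder (Elem A)] (hM : IsElemSubmodel M (H κ)) (hA : latticeCode A ∈ M) :
    BoundedOrder (traceLattice A hM hA) where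
  top := ⟨⊤, (hM.of_pair_mem
    (hM.of_pair_mem (hM.of_pair_mem (hM.of_pair_mem hA).2).2).2).2⟩
  le_top := fun _ => le_top (α := Elem A)
  bot := ⟨⊥, (hM.of_pair_mem
    (hM.of_pair_mem (hM.of_pair_mem (hM.of_pair_mem hA).2).2).2).1⟩
  bot_le := fun _ => bot_le (α := Elem A)

end Trace

end MC

/-!
The property `m`-`C` of `wL` depends only on the order of `L`. Ultrafilters on a distributive
lattice are prime and `wL` is compact, so open covers and disjoint open families can be replaced by
basic ones; in a separative lattice, inclusion of basic closed sets is the order of `L`. Passing to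
complements, `wL` is an `m`-`C`-space if and only if every sequence of `m`-tuples of elements of `L`
with meet `⊥` lies below a sequence of `m`-tuples with pairwise joins `⊤`, of which finitely many
entries have meet `⊥` (`IsMCLattice`, `isMCSpace_wallman_iff`). Covers with exactly `m` members
cause no loss, because an infinite `T₁` space has enough open sets to pad a smaller cover and a
finite one is discrete (`isMCSpace_iff_indexed`).

Let `K` be the trace on `M` of a lattice `K*` that belongs to `M ≺ H κ`. If `K*` has the lattice
property, a sequence in `K` has a refinement in `K*`, and the finite part of it that matters solves
a finite system of conditions with parameters in `M`; by elementarity the system has a solution in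
`K` (`traceLattice.isMCLattice_of`). Conversely, suppose that a sequence in `K*` has no refinement.
As `κ` is uncountable, `H κ` contains a code of such a sequence, and that a code describes a
sequence without refinement is a first-order statement (`GraphBad`). In it "no finite meet is `⊥`"
is expressed by the existence of a proper filter base, and the index set is any nonempty set
without `∈`-maximal element, so that natural numbers need not be defined. By elementarity `M`
contains a code, from which a sequence in `K` is read off. If this sequence had a refinement in
`K`, the refinement would be coded in `H κ` and contradict the statement
(`traceLattice.isMCLattice_iff`).

First-order definability is handled semantically: `IsDef P` says that some formula defines `P`, and
the logical operations preserve it.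
-/

namespace MC

/-! ### Indexed covers -/

/-- A family of open sets that covers an infinite `T₁` space and has at most `m` members is
refined by an open cover with exactly `m` members: some member is infinite, and removing points
from it one at a time yields as many further open sets as needed. -/
theorem exists_refinement_encard_eq {X : Type*} [TopologicalSpace X] [T1Space X] [Infinite X]
    {m : ℕ} (U : Fin m → Set X) (hU : ∀ j, IsOpen (U j)) (hc : ⋃ j, U j = Set.univ) :
    ∃ 𝒰 : Set (Set X), 𝒰.encard = m ∧ (∀ O ∈ 𝒰, IsOpen O) ∧ ⋃₀ 𝒰 = Set.univ ∧
      ∀ O ∈ 𝒰, ∃ j, O ⊆ U j := by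
  obtain ⟨j, hj⟩ : ∃ j, (U j).Infinite := by
    by_contra! h
    exact Set.infinite_univ (hc ▸ Set.finite_iUnion h)
  have hinf : {O : Set X | IsOpen O ∧ ∃ j, O ⊆ U j}.Infinite := by
    refine (hj.image (f := fun x => U j \ {x}) ?_).mono ?_
    · intro x hx y hy hxy
      by_contra hne
      have : x ∈ U j \ {x} := by
        simp only at hxy
        rw [hxy]; exact ⟨hx, hne⟩
      exact this.2 rfl
    · rintro _ ⟨x, -, rfl⟩
      exact ⟨(hU j).sdiff isClosed_singleton, j, Set.sdiff_subset⟩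
  have hr : (Set.range U).encard ≤ m := by
    rw [← Set.image_univ]
    refine (Set.encard_image_le _ _).trans ?_
    simp
  obtain ⟨𝒰, h1, h2, h3⟩ := Set.exists_superset_subset_encard_eq
    (s := Set.range U) (t := {O : Set X | IsOpen O ∧ ∃ j, O ⊆ U j}) (k := (m : ℕ∞))
    (by rintro _ ⟨k, rfl⟩; exact ⟨hU k, k, subset_rfl⟩) hr
    (by rw [hinf.encard_eq]; exact le_top)
  refine ⟨𝒰, h3, fun O hO => (h2 hO).1, ?_, fun O hO => (h2 hO).2⟩
  rw [Set.eq_univ_iff_forall] at hc ⊢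
  intro x
  obtain ⟨k, hk⟩ := Set.mem_iUnion.1 (hc x)
  exact ⟨U k, h1 ⟨k, rfl⟩, hk⟩

/-- In a `T₁` space the property `m`-`C` may be tested on indexed covers `U i 0, …, U i (m - 1)`,
with repetitions allowed, and the disjoint families may be taken to be shrinkings of them. -/
theorem isMCSpace_iff_indexed {X : Type*} [TopologicalSpace X] [T1Space X] (m : ℕ) :
    IsMCSpace m X ↔ ∀ U : ℕ → Fin m → Set X, (∀ i j, IsOpen (U i j)) →
      (∀ i, ⋃ j, U i j = Set.univ) → ∃ V : ℕ → Fin m → Set X, (∀ i j, IsOpen (V i j)) ∧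
        (∀ i j, V i j ⊆ U i j) ∧ (∀ i, Pairwise fun j k => Disjoint (V i j) (V i k)) ∧
        ⋃ i, ⋃ j, V i j = Set.univ := by
  constructor
  · intro h U hU hc
    cases finite_or_infinite X
    · -- A finite `T₁` space is discrete, so the first cover already has a disjoint shrinking.
      have hx : ∀ x, ∃ j, x ∈ U 0 j := fun x => Set.mem_iUnion.1 (hc 0 ▸ Set.mem_univ x)
      choose f hf using hx
      refine ⟨fun i j => {x | i = 0 ∧ f x = j}, fun i j => isOpen_discrete _, ?_, ?_, ?_⟩
      · rintro i j x ⟨rfl, rfl⟩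
        exact hf x
      · intro i j k hjk
        rw [Set.disjoint_left]
        rintro x ⟨-, h1⟩ ⟨-, h2⟩
        exact hjk (h1.symm.trans h2)
      · rw [Set.eq_univ_iff_forall]
        intro x
        exact Set.mem_iUnion.2 ⟨0, Set.mem_iUnion.2 ⟨f x, rfl, rfl⟩⟩
    · choose 𝒰 h1 h2 h3 h4 using fun i => exists_refinement_encard_eq (U i) (hU i) (hc i)
      obtain ⟨𝒱, h5, h6⟩ := h 𝒰 fun i => ⟨h1 i, h2 i, h3 i⟩
      have hg : ∀ i (V : 𝒱 i), ∃ j, V.1 ⊆ U i j := by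
        intro i V
        obtain ⟨O, hO, hVO⟩ := (h5 i).2.2 V.1 V.2
        obtain ⟨j, hj⟩ := h4 i O hO
        exact ⟨j, hVO.trans hj⟩
      choose g hg using hg
      refine ⟨fun i j => ⋃ V : {V : 𝒱 i // g i V = j}, V.1.1, ?_, ?_, ?_, ?_⟩
      · exact fun i j => isOpen_iUnion fun V => (h5 i).1 _ V.1.2
      · refine fun i j => Set.iUnion_subset ?_
        rintro ⟨V, rfl⟩
        exact hg i V
      · intro i j k hjk
        simp only [Set.disjoint_iUnion_left, Set.disjoint_iUnion_right]
        rintro ⟨V, rfl⟩ ⟨W, rfl⟩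
        exact (h5 i).2.1 W.2 V.2 fun e => hjk (congrArg (g i) (Subtype.ext e))
      · rw [Set.eq_univ_iff_forall] at h6 ⊢
        intro x
        obtain ⟨i, V, hV, hx⟩ := Set.mem_iUnion.1 (h6 x)
        exact Set.mem_iUnion.2 ⟨i, Set.mem_iUnion.2 ⟨g i ⟨V, hV⟩,
          Set.mem_iUnion.2 ⟨⟨⟨V, hV⟩, rfl⟩, hx⟩⟩⟩
  · intro h 𝒰 h𝒰
    have he : ∀ i, ∃ e : Fin m → Set X, Set.range e = 𝒰 i := by
      intro i
      have hfin : (𝒰 i).Finite := Set.finite_of_encard_eq_coe (h𝒰 i).1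
      have hcard : Nat.card (𝒰 i) = m := by
        have := (h𝒰 i).1
        rw [← hfin.cast_ncard_eq] at this
        exact_mod_cast this
      have := hfin.to_subtype
      obtain ⟨e⟩ : Nonempty (Fin m ≃ 𝒰 i) := ⟨(Finite.equivFinOfCardEq hcard).symm⟩
      refine ⟨fun j => (e j).1, ?_⟩
      rw [← Function.comp_def, Set.range_comp, e.range_eq_univ, Set.image_univ,
        Subtype.range_coe]
    choose e he using he
    obtain ⟨V, h1, h2, h3, h4⟩ := h e
      (fun i j => (h𝒰 i).2.1 _ (he i ▸ ⟨j, rfl⟩))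
      (fun i => by rw [← Set.sUnion_range, he, (h𝒰 i).2.2])
    refine ⟨fun i => Set.range (V i), fun i => ⟨?_, ?_, ?_⟩, ?_⟩
    · rintro _ ⟨j, rfl⟩
      exact h1 i j
    · rintro _ ⟨j, rfl⟩ _ ⟨k, rfl⟩ hjk
      exact h3 i fun hk => hjk (congrArg (V i) hk)
    · rintro _ ⟨j, rfl⟩
      exact ⟨e i j, he i ▸ ⟨j, rfl⟩, h2 i j⟩
    · simpa only [Set.sUnion_range] using h4

/-! ### Ultrafilters on lattices -/

section Wallman

variable {L : Type*}

theorem IsProperFilter.finset_inf_mem [Lattice L] [BoundedOrder L] {F : Set L}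
    (hF : IsProperFilter F) {ι : Type*} (s : Finset ι) (x : ι → L) (h : ∀ k ∈ s, x k ∈ F) :
    s.inf x ∈ F :=
  Finset.inf_induction hF.top_mem hF.inf_mem h

theorem IsProperFilter.exists_le_maximal [Lattice L] [BoundedOrder L] {F : Set L}
    (hF : IsProperFilter F) : ∃ p : Wallman L, F ⊆ p.1 := by
  obtain ⟨p, hFp, hp⟩ := zorn_subset_nonempty {F : Set L | IsProperFilter F} (by
    intro c hc hchain hne
    obtain ⟨F₀, hF₀⟩ := hne
    refine ⟨⋃₀ c, ⟨⟨F₀, hF₀, (hc hF₀).top_mem⟩, ?_, ?_, ?_⟩,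
      fun s hs => Set.subset_sUnion_of_mem hs⟩
    · rintro ⟨s, hs, h⟩
      exact (hc hs).bot_notMem h
    · rintro a ⟨s, hs, ha⟩ b ⟨t, ht, hb⟩
      rcases hchain.total hs ht with hst | hst
      · exact ⟨t, ht, (hc ht).inf_mem a (hst ha) b hb⟩
      · exact ⟨s, hs, (hc hs).inf_mem a ha b (hst hb)⟩
    · rintro a ⟨s, hs, ha⟩ b hab
      exact ⟨s, hs, (hc hs).mem_of_le a ha b hab⟩) F hF
  exact ⟨⟨p, hp⟩, hFp⟩

theorem Wallman.exists_mem_of_ne_bot [Lattice L] [BoundedOrder L] {c : L} (hc : c ≠ ⊥) :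
    ∃ p : Wallman L, c ∈ p.1 := by
  obtain ⟨p, hp⟩ := IsProperFilter.exists_le_maximal (F := Set.Ici c)
    ⟨le_top, fun h => hc (le_bot_iff.1 h), fun a ha b hb => le_inf ha hb,
      fun a ha b hab => le_trans ha hab⟩
  exact ⟨p, hp le_rfl⟩

/-- Compactness of the Wallman space: if no ultrafilter contains all the sets `I k`, each of them
closed under finite meets, then some finite meet of elements of different `I k` is `⊥`. -/
theorem exists_finset_inf_eq_bot [Lattice L] [BoundedOrder L] {ι : Type*} (I : ι → Set L)
    (htop : ∀ k, ⊤ ∈ I k) (hinf : ∀ k, ∀ a ∈ I k, ∀ b ∈ I k, a ⊓ b ∈ I k)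
    (h : ∀ p : Wallman L, ∃ k, ∃ a ∈ I k, a ∉ p.1) :
    ∃ x : ι → L, (∀ k, x k ∈ I k) ∧ ∃ s : Finset ι, s.inf x = ⊥ := by
  classical
  by_contra! hne
  obtain ⟨p, hp⟩ := IsProperFilter.exists_le_maximal
    (F := {z | ∃ x : ι → L, (∀ k, x k ∈ I k) ∧ ∃ s : Finset ι, s.inf x ≤ z}) (by
    refine ⟨⟨fun _ => ⊤, htop, ∅, le_top⟩, ?_, ?_, ?_⟩
    · rintro ⟨x, hx, s, hs⟩
      exact hne x hx s (le_bot_iff.1 hs)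
    · rintro a ⟨x, hx, s, hs⟩ b ⟨y, hy, t, ht⟩
      refine ⟨fun k => x k ⊓ y k, fun k => hinf k _ (hx k) _ (hy k), s ∪ t, le_inf ?_ ?_⟩
      · exact ((Finset.inf_mono Finset.subset_union_left).trans
          (Finset.inf_mono_fun fun k _ => inf_le_left)).trans hs
      · exact ((Finset.inf_mono Finset.subset_union_right).trans
          (Finset.inf_mono_fun fun k _ => inf_le_right)).trans ht
    · rintro a ⟨x, hx, s, hs⟩ b hab
      exact ⟨x, hx, s, hs.trans hab⟩)
  obtain ⟨k, a, ha, hap⟩ := h p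
  refine hap (hp ⟨Function.update (fun _ => ⊤) k a, fun l => ?_, {k}, ?_⟩)
  · by_cases hl : l = k
    · subst hl; simpa using ha
    · simpa [hl] using htop l
  · simp

/-- Ultrafilters on a distributive lattice are prime. -/
theorem Wallman.mem_or_mem [DistribLattice L] [BoundedOrder L] (p : Wallman L) {a b : L}
    (h : a ⊔ b ∈ p.1) : a ∈ p.1 ∨ b ∈ p.1 := by
  by_contra! hab
  have key : ∀ c, c ∉ p.1 → ∃ x ∈ p.1, x ⊓ c = ⊥ := by
    intro c hc
    by_contra! hne
    have hF : IsProperFilter {z | ∃ x ∈ p.1, x ⊓ c ≤ z} := by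
      refine ⟨⟨⊤, p.2.prop.top_mem, le_top⟩, ?_, ?_, ?_⟩
      · rintro ⟨x, hx, h⟩
        exact hne x hx (le_bot_iff.1 h)
      · rintro s ⟨x, hx, hs⟩ t ⟨y, hy, ht⟩
        refine ⟨x ⊓ y, p.2.prop.inf_mem x hx y hy, le_inf ?_ ?_⟩
        · exact (inf_le_inf_right c inf_le_left).trans hs
        · exact (inf_le_inf_right c inf_le_right).trans ht
      · rintro s ⟨x, hx, hs⟩ t hst
        exact ⟨x, hx, hs.trans hst⟩
    exact hc (p.2.le_of_ge hF (fun x hx => ⟨x, hx, inf_le_left⟩)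
      ⟨⊤, p.2.prop.top_mem, inf_le_right⟩)
  obtain ⟨x, hx, hxa⟩ := key a hab.1
  obtain ⟨y, hy, hyb⟩ := key b hab.2
  refine p.2.prop.bot_notMem ?_
  have := p.2.prop.inf_mem _ (p.2.prop.inf_mem x hx y hy) _ h
  rwa [inf_sup_left, inf_right_comm, hxa, bot_inf_eq, inf_assoc, hyb, inf_bot_eq, sup_bot_eq]
    at this

theorem IsSeparative.le_of_forall_mem [Lattice L] [BoundedOrder L] (hL : IsSeparative L)
    {a b : L} (h : ∀ p : Wallman L, a ∈ p.1 → b ∈ p.1) : a ≤ b := by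
  by_contra hab
  obtain ⟨c, hc, hca, hcb⟩ := hL a b hab
  obtain ⟨p, hp⟩ := Wallman.exists_mem_of_ne_bot hc
  refine p.2.prop.bot_notMem (hcb ▸ p.2.prop.inf_mem c hp b (h p ?_))
  exact p.2.prop.mem_of_le c hp a hca

/-! ### The Wallman space -/

theorem Wallman.isOpen_compl_hat [Lattice L] [BoundedOrder L] (a : L) :
    IsOpen (Wallman.hat a)ᶜ :=
  TopologicalSpace.isOpen_generateFrom_of_mem ⟨a, rfl⟩

instance Wallman.instT1Space [Lattice L] [BoundedOrder L] : T1Space (Wallman L) := by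
  rw [t1Space_iff_exists_open]
  intro p q hpq
  obtain ⟨a, haq, hap⟩ := Set.not_subset.1
    fun h => hpq (Subtype.ext (q.2.eq_of_le p.2.prop h).symm)
  exact ⟨(Wallman.hat a)ᶜ, Wallman.isOpen_compl_hat a, hap, fun h => h haq⟩

/-- The sets `â` are a base for the closed sets. -/
theorem Wallman.exists_compl_hat_subset [DistribLattice L] [BoundedOrder L]
    {U : Set (Wallman L)} (hU : IsOpen U) {p : Wallman L} (hp : p ∈ U) :
    ∃ a, a ∉ p.1 ∧ (Wallman.hat a)ᶜ ⊆ U := by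
  induction hU with
  | basic s hs =>
    obtain ⟨a, rfl⟩ := hs
    exact ⟨a, hp, subset_rfl⟩
  | univ => exact ⟨⊥, p.2.prop.bot_notMem, Set.subset_univ _⟩
  | inter s t _ _ ihs iht =>
    obtain ⟨a, hap, has⟩ := ihs hp.1
    obtain ⟨b, hbp, hbt⟩ := iht hp.2
    refine ⟨a ⊔ b, fun h => (p.mem_or_mem h).elim hap hbp, fun q hq => ⟨has ?_, hbt ?_⟩⟩
    · exact fun h => hq (q.2.prop.mem_of_le _ h _ le_sup_left)
    · exact fun h => hq (q.2.prop.mem_of_le _ h _ le_sup_right)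
  | sUnion S _ ih =>
    obtain ⟨s, hs, hps⟩ := hp
    obtain ⟨a, hap, has⟩ := ih s hs hps
    exact ⟨a, hap, has.trans (Set.subset_sUnion_of_mem hs)⟩

/-- Open covers and disjointness in `wL` are dual to meets and joins in `L`. This is the property
`m`-`C` of `wL` in terms of `L`: every sequence of `m`-tuples with meet `⊥` is dominated by a
sequence of `m`-tuples with pairwise joins `⊤` such that the meet of finitely many of their
entries is `⊥`. -/
def IsMCLattice (m : ℕ) (L : Type*) [Lattice L] [BoundedOrder L] : Prop :=
  ∀ u : ℕ → Fin m → L, (∀ i, Finset.univ.inf (u i) = ⊥) →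
    ∃ v : ℕ → Fin m → L, (∀ i j, u i j ≤ v i j) ∧
      (∀ i, Pairwise fun j k => v i j ⊔ v i k = ⊤) ∧
      ∃ s : Finset (ℕ × Fin m), (s.inf fun k => v k.1 k.2) = ⊥

/-- The closed sets `x̂` that contain the complement of a given set are closed under finite
intersections. -/
theorem Wallman.compl_hat_inf_subset [Lattice L] [BoundedOrder L] {U : Set (Wallman L)} {a b : L}
    (ha : (Wallman.hat a)ᶜ ⊆ U) (hb : (Wallman.hat b)ᶜ ⊆ U) : (Wallman.hat (a ⊓ b))ᶜ ⊆ U := by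
  intro p hp
  by_cases h : a ∈ p.1
  · exact hb fun h' => hp (p.2.prop.inf_mem a h b h')
  · exact ha h

theorem Wallman.compl_hat_top_subset [Lattice L] [BoundedOrder L] (U : Set (Wallman L)) :
    (Wallman.hat (⊤ : L))ᶜ ⊆ U :=
  fun p hp => absurd p.2.prop.top_mem hp

theorem isMCSpace_wallman_iff [DistribLattice L] [BoundedOrder L] (hL : IsSeparative L) (m : ℕ) :
    IsMCSpace m (Wallman L) ↔ IsMCLattice m L := by
  rw [isMCSpace_iff_indexed]
  constructor
  · intro h u hu
    obtain ⟨V, h1, h2, h3, h4⟩ := h (fun i j => (Wallman.hat (u i j))ᶜ)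
      (fun i j => Wallman.isOpen_compl_hat _) (by
        intro i
        rw [Set.eq_univ_iff_forall]
        intro p
        by_contra hp
        refine p.2.prop.bot_notMem (hu i ▸ p.2.prop.finset_inf_mem _ _ fun j _ => ?_)
        by_contra hj
        exact hp (Set.mem_iUnion.2 ⟨j, hj⟩))
    obtain ⟨x, hx, s, hs⟩ := exists_finset_inf_eq_bot
      (fun k : ℕ × Fin m => {a : L | (Wallman.hat a)ᶜ ⊆ V k.1 k.2})
      (fun k => Wallman.compl_hat_top_subset _)
      (fun k a ha b hb => Wallman.compl_hat_inf_subset ha hb) (by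
        intro p
        obtain ⟨i, hi⟩ := Set.mem_iUnion.1 (h4 ▸ Set.mem_univ p)
        obtain ⟨j, hj⟩ := Set.mem_iUnion.1 hi
        obtain ⟨a, hap, ha⟩ := Wallman.exists_compl_hat_subset (h1 i j) hj
        exact ⟨(i, j), a, ha, hap⟩)
    refine ⟨fun i j => x (i, j), fun i j => ?_, fun i j k hjk => ?_, s, hs⟩
    · refine hL.le_of_forall_mem fun p hp => ?_
      by_contra hxp
      exact h2 i j (hx (i, j) hxp) hp
    · refine top_le_iff.1 (hL.le_of_forall_mem fun p _ => ?_)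
      by_contra hxp
      refine Set.disjoint_left.1 (h3 i hjk) (hx (i, j) (a := p) ?_) (hx (i, k) ?_)
      · exact fun h => hxp (p.2.prop.mem_of_le _ h _ le_sup_left)
      · exact fun h => hxp (p.2.prop.mem_of_le _ h _ le_sup_right)
  · intro h U hU hc
    have hu : ∀ i, ∃ x : Fin m → L, (∀ j, (Wallman.hat (x j))ᶜ ⊆ U i j) ∧
        Finset.univ.inf x = ⊥ := by
      intro i
      obtain ⟨x, hx, s, hs⟩ := exists_finset_inf_eq_bot
        (fun j : Fin m => {a : L | (Wallman.hat a)ᶜ ⊆ U i j})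
        (fun j => Wallman.compl_hat_top_subset _)
        (fun j a ha b hb => Wallman.compl_hat_inf_subset ha hb) (by
          intro p
          obtain ⟨j, hj⟩ := Set.mem_iUnion.1 (hc i ▸ Set.mem_univ p)
          obtain ⟨a, hap, ha⟩ := Wallman.exists_compl_hat_subset (hU i j) hj
          exact ⟨j, a, ha, hap⟩)
      exact ⟨x, hx, le_bot_iff.1 (hs ▸ Finset.inf_mono (Finset.subset_univ s))⟩
    choose u h1 h2 using hu
    obtain ⟨v, h3, h4, s, hs⟩ := h u h2
    refine ⟨fun i j => (Wallman.hat (v i j))ᶜ, fun i j => Wallman.isOpen_compl_hat _, ?_, ?_, ?_⟩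
    · intro i j p hp
      exact h1 i j fun h => hp (p.2.prop.mem_of_le _ h _ (h3 i j))
    · intro i j k hjk
      rw [Set.disjoint_left]
      intro p hj hk
      exact (p.mem_or_mem (h4 i hjk ▸ p.2.prop.top_mem)).elim hj hk
    · rw [Set.eq_univ_iff_forall]
      intro p
      by_contra hp
      refine p.2.prop.bot_notMem (hs ▸ p.2.prop.finset_inf_mem _ _ fun k _ => ?_)
      by_contra hk
      exact hp (Set.mem_iUnion.2 ⟨k.1, Set.mem_iUnion.2 ⟨k.2, hk⟩⟩)

end Wallman

/-! ### Definable relations on classes of sets -/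

section Definability

open FirstOrder FirstOrder.Language

variable {N : Set ZFSet.{u}} {α β : Type}

/-- The property `P` of valuations of the variables `α` in `(N, ∈)` is first-order definable
without parameters. -/
def IsDef (P : (α → N) → Prop) : Prop :=
  ∃ φ : setLang.Formula α, ∀ v, φ.Realize v ↔ P v

theorem IsDef.congr {P Q : (α → N) → Prop} (h : IsDef P) (hPQ : ∀ v, P v ↔ Q v) : IsDef Q :=
  h.imp fun _ hφ v => (hφ v).trans (hPQ v)

theorem isDef_mem (i j : α) : IsDef fun v : α → N => (v i).1 ∈ (v j).1 :=
  ⟨Relations.formula₂ memRel (Term.var i) (Term.var j), fun _ => by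
    rw [Formula.realize_rel₂]; rfl⟩

theorem isDef_eq (i j : α) : IsDef fun v : α → N => v i = v j :=
  ⟨Term.equal (Term.var i) (Term.var j), fun _ => by simp [Formula.realize_equal]⟩

theorem IsDef.not {P : (α → N) → Prop} (h : IsDef P) : IsDef fun v => ¬ P v := by
  obtain ⟨φ, hφ⟩ := h
  exact ⟨φ.not, fun v => by rw [Formula.realize_not, hφ]⟩

theorem IsDef.and {P Q : (α → N) → Prop} (h : IsDef P) (h' : IsDef Q) :
    IsDef fun v => P v ∧ Q v := by
  obtain ⟨φ, hφ⟩ := h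
  obtain ⟨ψ, hψ⟩ := h'
  exact ⟨φ ⊓ ψ, fun v => by rw [Formula.realize_inf, hφ, hψ]⟩

theorem IsDef.imp {P Q : (α → N) → Prop} (h : IsDef P) (h' : IsDef Q) :
    IsDef fun v => P v → Q v :=
  (h.and h'.not).not.congr fun v => by tauto

theorem IsDef.or {P Q : (α → N) → Prop} (h : IsDef P) (h' : IsDef Q) :
    IsDef fun v => P v ∨ Q v :=
  (h.not.imp h').congr fun v => by tauto

theorem isDef_const (p : Prop) : IsDef fun _ : α → N => p := by
  by_cases hp : p
  · exact ⟨⊤, fun v => by simp [hp]⟩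
  · exact ⟨⊥, fun v => by simp [hp]⟩

/-- Quantification over a finite index set, as opposed to the elements of `N`. -/
theorem IsDef.forall_index [Finite β] {P : β → (α → N) → Prop} (h : ∀ j, IsDef (P j)) :
    IsDef fun v => ∀ j, P j v := by
  choose φ hφ using h
  exact ⟨Formula.iInf φ, fun v => by simp [Formula.realize_iInf, hφ]⟩

theorem IsDef.exists_block [Finite β] {P : (α → N) → (β → N) → Prop}
    (h : IsDef fun v : α ⊕ β → N => P (fun i => v (Sum.inl i)) (fun i => v (Sum.inr i))) :
    IsDef fun v => ∃ x, P v x := by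
  obtain ⟨φ, hφ⟩ := h
  exact ⟨φ.iExs β, fun v => by simp [Formula.realize_iExs, hφ]⟩

theorem IsDef.forall_block [Finite β] {P : (α → N) → (β → N) → Prop}
    (h : IsDef fun v : α ⊕ β → N => P (fun i => v (Sum.inl i)) (fun i => v (Sum.inr i))) :
    IsDef fun v => ∀ x, P v x :=
  (IsDef.exists_block (P := fun v x => ¬ P v x) h.not).not.congr fun v => by simp

theorem IsDef.exists {P : (α → N) → N → Prop}
    (h : IsDef fun v : α ⊕ Unit → N => P (fun i => v (Sum.inl i)) (v (Sum.inr ()))) :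
    IsDef fun v => ∃ x, P v x :=
  (IsDef.exists_block (β := Unit) (P := fun v x => P v (x ())) h).congr fun _ =>
    ⟨fun ⟨x, hx⟩ => ⟨x (), hx⟩, fun ⟨x, hx⟩ => ⟨fun _ => x, hx⟩⟩

theorem IsDef.forall {P : (α → N) → N → Prop}
    (h : IsDef fun v : α ⊕ Unit → N => P (fun i => v (Sum.inl i)) (v (Sum.inr ()))) :
    IsDef fun v => ∀ x, P v x :=
  (IsDef.exists (P := fun v x => ¬ P v x) h.not).not.congr fun v => by simp

/-- Elementarity: a definable property with parameters in `M ≺ N` that has a witness in `N`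
has one in `M`. -/
theorem IsElemSubmodel.exists_of_isDef {M : Set ZFSet.{u}} (hM : IsElemSubmodel M N) [Finite β]
    {P : (α → N) → (β → N) → Prop}
    (h : IsDef fun v : α ⊕ β → N => P (fun i => v (Sum.inl i)) (fun i => v (Sum.inr i)))
    (a : α → N) (ha : ∀ i, (a i).1 ∈ M) (hx : ∃ x, P a x) :
    ∃ x : β → N, (∀ i, (x i).1 ∈ M) ∧ P a x := by
  obtain ⟨S, rfl⟩ := hM
  obtain ⟨φ, hφ⟩ := h
  have hS : ∀ i, a i ∈ S := by
    intro i
    obtain ⟨b, hb, e⟩ := ha i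
    rwa [← Subtype.ext e]
  have key := S.subtype.map_formula (φ.iExs β) (fun i => ⟨a i, hS i⟩)
  obtain ⟨x, hx⟩ := hx
  have h1 : (φ.iExs β).Realize a := by
    rw [Formula.realize_iExs]
    exact ⟨x, (hφ _).2 hx⟩
  obtain ⟨y, hy⟩ := Formula.realize_iExs.1 (key.1 h1)
  refine ⟨fun i => (y i).1, fun i => ⟨_, (y i).2, rfl⟩, ?_⟩
  have := (hφ _).1 ((S.subtype.map_formula φ _).2 hy)
  exact this

theorem IsElemSubmodel.exists_of_isDef_single {M : Set ZFSet.{u}} (hM : IsElemSubmodel M N)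
    {P : (α → N) → N → Prop}
    (h : IsDef fun v : α ⊕ Unit → N => P (fun i => v (Sum.inl i)) (v (Sum.inr ())))
    (a : α → N) (ha : ∀ i, (a i).1 ∈ M) (hx : ∃ x, P a x) : ∃ x : N, x.1 ∈ M ∧ P a x := by
  obtain ⟨x, hx⟩ := hx
  obtain ⟨y, hy, hP⟩ := hM.exists_of_isDef (β := Unit) (P := fun v x => P v (x ())) h a ha
    ⟨fun _ => x, hx⟩
  exact ⟨y (), hy (), hP⟩

/-- Ordered pairs are definable in transitive classes. -/
theorem isDef_pair (hN : ∀ x ∈ N, ∀ y ∈ x, y ∈ N) (p a b : α) :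
    IsDef fun v : α → N => (v p).1 = ZFSet.pair (v a).1 (v b).1 := by
  have h : IsDef fun v : α → N =>
      (∃ z : N, z.1 ∈ (v p).1 ∧ ((v a).1 ∈ z.1 ∧ ∀ y : N, y.1 ∈ z.1 → y = v a)) ∧
      (∃ z : N, z.1 ∈ (v p).1 ∧ ((v a).1 ∈ z.1 ∧ (v b).1 ∈ z.1 ∧
        ∀ y : N, y.1 ∈ z.1 → y = v a ∨ y = v b)) ∧
      ∀ z : N, z.1 ∈ (v p).1 → ((v a).1 ∈ z.1 ∧ ∀ y : N, y.1 ∈ z.1 → y = v a) ∨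
        ((v a).1 ∈ z.1 ∧ (v b).1 ∈ z.1 ∧ ∀ y : N, y.1 ∈ z.1 → y = v a ∨ y = v b) := by
    refine .and (.exists <| .and (isDef_mem _ _) <| .and (isDef_mem _ _) <| .forall <|
        .imp (isDef_mem _ _) (isDef_eq _ _)) <|
      .and (.exists <| .and (isDef_mem _ _) <| .and (isDef_mem _ _) <| .and (isDef_mem _ _) <|
        .forall <| .imp (isDef_mem _ _) <| .or (isDef_eq _ _) (isDef_eq _ _)) <|
      .forall <| .imp (isDef_mem _ _) <| .or
        (.and (isDef_mem _ _) <| .forall <| .imp (isDef_mem _ _) (isDef_eq _ _))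
        (.and (isDef_mem _ _) <| .and (isDef_mem _ _) <|
          .forall <| .imp (isDef_mem _ _) <| .or (isDef_eq _ _) (isDef_eq _ _))
  refine h.congr fun v => ?_
  have h1 : ∀ z : N, (v a).1 ∈ z.1 ∧ (∀ y : N, y.1 ∈ z.1 → y = v a) ↔ z.1 = {(v a).1} := by
    intro z
    constructor
    · rintro ⟨ha, h⟩
      ext y
      rw [ZFSet.mem_singleton]
      exact ⟨fun hy => congrArg Subtype.val (h ⟨y, hN _ z.2 _ hy⟩ hy), fun e => e ▸ ha⟩
    · intro h
      simp [h, Subtype.ext_iff]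
  have h2 : ∀ z : N, ((v a).1 ∈ z.1 ∧ (v b).1 ∈ z.1 ∧ ∀ y : N, y.1 ∈ z.1 → y = v a ∨ y = v b) ↔
      z.1 = {(v a).1, (v b).1} := by
    intro z
    constructor
    · rintro ⟨ha, hb, h⟩
      ext y
      rw [ZFSet.mem_pair]
      refine ⟨fun hy => (h ⟨y, hN _ z.2 _ hy⟩ hy).imp (congrArg Subtype.val)
        (congrArg Subtype.val), ?_⟩
      rintro (rfl | rfl)
      exacts [ha, hb]
    · intro h
      simp [h, Subtype.ext_iff]
  simp only [h1, h2]
  constructor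
  · rintro ⟨⟨z, hz, e⟩, ⟨z', hz', e'⟩, h⟩
    ext y
    rw [ZFSet.pair, ZFSet.mem_pair]
    refine ⟨fun hy => h ⟨y, hN _ (v p).2 _ hy⟩ hy, ?_⟩
    rintro (rfl | rfl)
    exacts [e ▸ hz, e' ▸ hz']
  · intro h
    have hz : ({(v a).1} : ZFSet) ∈ (v p).1 := by rw [h, ZFSet.pair]; simp
    have hz' : ({(v a).1, (v b).1} : ZFSet) ∈ (v p).1 := by rw [h, ZFSet.pair]; simp
    refine ⟨⟨⟨_, hN _ (v p).2 _ hz⟩, hz, rfl⟩, ⟨⟨_, hN _ (v p).2 _ hz'⟩, hz', rfl⟩, ?_⟩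
    intro z hz
    rwa [h, ZFSet.pair, ZFSet.mem_pair] at hz

theorem isDef_pair_mem (hN : ∀ x ∈ N, ∀ y ∈ x, y ∈ N) (a b s : α) :
    IsDef fun v : α → N => ZFSet.pair (v a).1 (v b).1 ∈ (v s).1 := by
  have h : IsDef fun v : α → N =>
      ∃ p : N, p.1 = ZFSet.pair (v a).1 (v b).1 ∧ p.1 ∈ (v s).1 :=
    .exists <| .and (isDef_pair hN _ _ _) (isDef_mem _ _)
  exact h.congr fun v =>
    ⟨fun ⟨p, e, h⟩ => e ▸ h, fun h => ⟨⟨_, hN _ (v s).2 _ h⟩, rfl, h⟩⟩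

/-- The relation `a ≤ b` is definable from the graph `g` of the operation `⊓`, since it says that
`((a, b), a)` belongs to `g`. -/
theorem isDef_inf_graph (hN : ∀ x ∈ N, ∀ y ∈ x, y ∈ N) (a b g : α) :
    IsDef fun v : α → N =>
      ZFSet.pair (ZFSet.pair (v a).1 (v b).1) (v a).1 ∈ (v g).1 := by
  have h : IsDef fun v : α → N =>
      ∃ p : N, p.1 = ZFSet.pair (v a).1 (v b).1 ∧ ZFSet.pair p.1 (v a).1 ∈ (v g).1 :=
    .exists <| .and (isDef_pair hN _ _ _) (isDef_pair_mem hN _ _ _)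
  refine h.congr fun v => ⟨fun ⟨p, e, h⟩ => e ▸ h, fun h => ⟨⟨_, ?_⟩, rfl, h⟩⟩
  have h1 := hN _ (v g).2 _ h
  have h2 := hN _ h1 {ZFSet.pair (v a).1 (v b).1} (ZFSet.mem_pair.2 (Or.inl rfl))
  exact hN _ h2 _ (ZFSet.mem_singleton.2 rfl)

end Definability

/-! ### Closure properties of `H κ` -/

theorem subset_transClosure (x : ZFSet.{u}) {y : ZFSet.{u}} (hy : y ∈ x) : y ∈ transClosure x :=
  ⟨0, hy⟩

theorem transClosure_transitive (x : ZFSet.{u}) {y z : ZFSet.{u}} (hy : y ∈ transClosure x)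
    (hz : z ∈ y) : z ∈ transClosure x := by
  obtain ⟨n, hn⟩ := hy
  refine ⟨n + 1, ?_⟩
  rw [Function.iterate_succ_apply']
  exact ZFSet.mem_sUnion.2 ⟨y, hn, hz⟩

theorem transClosure_subset {x : ZFSet.{u}} {T : Set ZFSet.{u}} (hx : ∀ y ∈ x, y ∈ T)
    (hT : ∀ y ∈ T, ∀ z ∈ y, z ∈ T) : transClosure x ⊆ T := by
  rintro y ⟨n, hn⟩
  induction n generalizing y with
  | zero => exact hx y hn
  | succ n ih =>
    rw [Function.iterate_succ_apply'] at hn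
    obtain ⟨w, hw, hyw⟩ := ZFSet.mem_sUnion.1 hn
    exact hT w (ih hw) y hyw

theorem mem_H_of_subset {κ : Cardinal.{u}} {x y : ZFSet.{u}} (hx : x ∈ H κ) (hy : y ⊆ x) :
    y ∈ H κ :=
  (Cardinal.mk_le_mk_of_subset (transClosure_subset
    (fun _ hz => subset_transClosure x (hy hz))
    fun _ hz _ hw => transClosure_transitive x hz hw)).trans_lt hx

/-- The pairs `(a, b)` with `a` and `b` in the transitive closures of `x` and `y`, their elements
`{a}` and `{a, b}`, and the two transitive closures together form a transitive set that is still
smaller than `κ`. -/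
theorem prod_mem_H {κ : Cardinal.{u}} (hκ : ℵ₀ ≤ κ) {x y : ZFSet.{u}} (hx : x ∈ H κ)
    (hy : y ∈ H κ) : x.prod y ∈ H κ := by
  have hκ' : ℵ₀ ≤ Cardinal.lift.{u + 1} κ := Cardinal.aleph0_le_lift.2 hκ
  set P := transClosure x ×ˢ transClosure y with hP
  have hPκ : #P < Cardinal.lift.{u + 1} κ := by
    rw [hP, Cardinal.mk_setProd]
    simpa using Cardinal.mul_lt_of_lt hκ' hx hy
  have him : ∀ f : ZFSet.{u} × ZFSet.{u} → ZFSet.{u}, #(f '' P) < Cardinal.lift.{u + 1} κ :=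
    fun f => Cardinal.mk_image_le.trans_lt hPκ
  refine (Cardinal.mk_le_mk_of_subset (transClosure_subset (T :=
    (fun p => ZFSet.pair p.1 p.2) '' P ∪ ((fun p => {p.1}) '' P ∪ ((fun p => {p.1, p.2}) '' P ∪
      (transClosure x ∪ transClosure y)))) ?_ ?_)).trans_lt ?_
  · intro p hp
    obtain ⟨a, ha, b, hb, rfl⟩ := ZFSet.mem_prod.1 hp
    exact Or.inl ⟨(a, b), ⟨subset_transClosure x ha, subset_transClosure y hb⟩, rfl⟩
  · rintro p (⟨⟨a, b⟩, hab, rfl⟩ | ⟨⟨a, b⟩, hab, rfl⟩ | ⟨⟨a, b⟩, hab, rfl⟩ | hp | hp) z hz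
    · simp only [ZFSet.pair, ZFSet.mem_pair] at hz
      rcases hz with rfl | rfl
      · exact Or.inr (Or.inl ⟨(a, b), hab, rfl⟩)
      · exact Or.inr (Or.inr (Or.inl ⟨(a, b), hab, rfl⟩))
    · simp only [ZFSet.mem_singleton] at hz
      subst hz
      exact Or.inr (Or.inr (Or.inr (Or.inl hab.1)))
    · simp only [ZFSet.mem_pair] at hz
      rcases hz with rfl | rfl
      · exact Or.inr (Or.inr (Or.inr (Or.inl hab.1)))
      · exact Or.inr (Or.inr (Or.inr (Or.inr hab.2)))
    · exact Or.inr (Or.inr (Or.inr (Or.inl (transClosure_transitive x hp hz))))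
    · exact Or.inr (Or.inr (Or.inr (Or.inr (transClosure_transitive y hp hz))))
  · have hu : ∀ s t : Set ZFSet.{u}, #s < Cardinal.lift.{u + 1} κ →
        #t < Cardinal.lift.{u + 1} κ → #(s ∪ t : Set ZFSet.{u}) < Cardinal.lift.{u + 1} κ :=
      fun s t hs ht => (Cardinal.mk_union_le s t).trans_lt (Cardinal.add_lt_of_lt hκ' hs ht)
    exact hu _ _ (him _) (hu _ _ (him _) (hu _ _ (him _) (hu _ _ hx hy)))

/-- The Zermelo numerals `∅, {∅}, {{∅}}, …`. -/
def zermelo : ℕ → ZFSet.{u}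
  | 0 => ∅
  | n + 1 => {zermelo n}

theorem zermelo_succ_ne_zero (n : ℕ) : zermelo.{u} (n + 1) ≠ zermelo 0 := fun e =>
  ZFSet.notMem_empty (zermelo n)
    ((show ({zermelo n} : ZFSet) = ∅ from e) ▸ ZFSet.mem_singleton.2 rfl)

theorem zermelo_injective : Function.Injective zermelo.{u} := by
  intro m n h
  induction m generalizing n with
  | zero =>
    cases n with
    | zero => rfl
    | succ n => exact absurd h (zermelo_succ_ne_zero n).symm
  | succ m ih =>
    cases n with
    | zero => exact absurd h (zermelo_succ_ne_zero m)
    | succ n => rw [ih (ZFSet.singleton_injective h)]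

theorem range_zermelo_mem_H {κ : Cardinal.{u}} (hκ : ℵ₀ < κ) :
    ZFSet.range.{u} zermelo.{u} ∈ H κ := by
  refine (Cardinal.mk_le_mk_of_subset (transClosure_subset (T := Set.range zermelo) ?_ ?_)).trans_lt
    ?_
  · intro y hy
    simpa using hy
  · rintro _ ⟨n, rfl⟩ z hz
    cases n with
    | zero => exact absurd hz (ZFSet.notMem_empty z)
    | succ n => exact ⟨n, (ZFSet.mem_singleton.1 hz).symm⟩
  · exact (Cardinal.mk_le_aleph0_iff.2 (Set.countable_range _).to_subtype).trans_lt
      (Cardinal.aleph0_lt_lift.2 hκ)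

/-! ### The order of a lattice in the language of set theory -/

section Order

/-- The order relation `x ≤ y` read off from the graph `g` of the operation `⊓`. The elements of
the lattice are the sets `x` with `GraphLE g x x`. -/
def GraphLE (g x y : ZFSet.{u}) : Prop := ZFSet.pair (ZFSet.pair x y) x ∈ g

/-- `z` is the least element of the order given by `g`, as seen by the class `N`. -/
def GraphBot {N : Set ZFSet.{u}} (g z : N) : Prop :=
  GraphLE g.1 z.1 z.1 ∧ ∀ y : N, GraphLE g.1 y.1 y.1 → GraphLE g.1 z.1 y.1

/-- `z` is the greatest element of the order given by `g`, as seen by the class `N`. -/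
def GraphTop {N : Set ZFSet.{u}} (g z : N) : Prop :=
  GraphLE g.1 z.1 z.1 ∧ ∀ y : N, GraphLE g.1 y.1 y.1 → GraphLE g.1 y.1 z.1

/-- The only common upper bound of `x` and `y` is the greatest element. -/
def GraphCodisjoint {N : Set ZFSet.{u}} (g x y : N) : Prop :=
  ∀ z : N, GraphLE g.1 x.1 z.1 → GraphLE g.1 y.1 z.1 → GraphTop g z

/-- The only common lower bound of the family `x` is the least element. -/
def GraphInfBot {N : Set ZFSet.{u}} {ι : Type} (g : N) (x : ι → N) : Prop :=
  ∀ z : N, GraphLE g.1 z.1 z.1 → (∀ j, GraphLE g.1 z.1 (x j).1) → GraphBot g z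

variable {N : Set ZFSet.{u}} {α : Type}

theorem isDef_graphLE (hN : ∀ x ∈ N, ∀ y ∈ x, y ∈ N) (g a b : α) :
    IsDef fun v : α → N => GraphLE (v g).1 (v a).1 (v b).1 :=
  isDef_inf_graph hN a b g

theorem isDef_graphBot (hN : ∀ x ∈ N, ∀ y ∈ x, y ∈ N) (g z : α) : IsDef fun v : α → N => GraphBot (v g) (v z) :=
  .and (isDef_graphLE hN _ _ _) <| .forall <|
    .imp (isDef_graphLE hN _ _ _) (isDef_graphLE hN _ _ _)

theorem isDef_graphTop (hN : ∀ x ∈ N, ∀ y ∈ x, y ∈ N) (g z : α) : IsDef fun v : α → N => GraphTop (v g) (v z) :=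
  .and (isDef_graphLE hN _ _ _) <| .forall <|
    .imp (isDef_graphLE hN _ _ _) (isDef_graphLE hN _ _ _)

theorem isDef_graphCodisjoint (hN : ∀ x ∈ N, ∀ y ∈ x, y ∈ N) (g x y : α) :
    IsDef fun v : α → N => GraphCodisjoint (v g) (v x) (v y) :=
  .forall <| .imp (isDef_graphLE hN _ _ _) <| .imp (isDef_graphLE hN _ _ _) <|
    isDef_graphTop hN _ _

theorem isDef_graphInfBot (hN : ∀ x ∈ N, ∀ y ∈ x, y ∈ N) {ι : Type} [Finite ι] (g : α) (x : ι → α) :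
    IsDef fun v : α → N => GraphInfBot (v g) fun j => v (x j) :=
  .forall <| .imp (isDef_graphLE hN _ _ _) <| .imp
    (.forall_index fun _ => isDef_graphLE hN _ _ _) <| isDef_graphBot hN _ _

/-- A counterexample to `IsMCLattice m` for the lattice with graph of meets `g`, coded by sets.
The set `D`, which has no `∈`-maximal element, indexes a sequence of `m`-tuples with meet `⊥`,
the `j`-th entries of which are given by the relation `s j`. It is a counterexample because every
refinement `w` by pairwise disjoint families is contained in a proper filter base `F`. -/
def GraphBad {N : Set ZFSet.{u}} {m : ℕ} (g D : N) (s : Fin m → N) : Prop :=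
  (∃ i : N, i.1 ∈ D.1) ∧
  (∀ i : N, i.1 ∈ D.1 → ∃ k : N, k.1 ∈ D.1 ∧ i.1 ∈ k.1) ∧
  (∀ i : N, i.1 ∈ D.1 → ∃ x : Fin m → N,
    (∀ j, ZFSet.pair i.1 (x j).1 ∈ (s j).1 ∧ GraphLE g.1 (x j).1 (x j).1) ∧ GraphInfBot g x) ∧
  ∀ w : Fin m → N,
    (∀ j, ∀ i x : N, ZFSet.pair i.1 x.1 ∈ (w j).1 →
      ∃ y : N, ZFSet.pair i.1 y.1 ∈ (s j).1 ∧ GraphLE g.1 y.1 x.1) →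
    (∀ j k, j ≠ k → ∀ i x y : N, ZFSet.pair i.1 x.1 ∈ (w j).1 → ZFSet.pair i.1 y.1 ∈ (w k).1 →
      GraphCodisjoint g x y) →
    ∃ F : N, (∃ x : N, x.1 ∈ F.1) ∧
      (∀ x y : N, x.1 ∈ F.1 → y.1 ∈ F.1 →
        ∃ z : N, z.1 ∈ F.1 ∧ GraphLE g.1 z.1 x.1 ∧ GraphLE g.1 z.1 y.1) ∧
      (∀ x : N, x.1 ∈ F.1 → ¬ GraphBot g x) ∧
      ∀ j, ∀ i x : N, ZFSet.pair i.1 x.1 ∈ (w j).1 → x.1 ∈ F.1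

theorem isDef_graphBad (hN : ∀ x ∈ N, ∀ y ∈ x, y ∈ N) {m : ℕ} (g D : α) (s : Fin m → α) :
    IsDef fun v : α → N => GraphBad (v g) (v D) fun j => v (s j) := by
  refine .and (.exists <| isDef_mem _ _) <|
    .and (.forall <| .imp (isDef_mem _ _) <| .exists <| .and (isDef_mem _ _) (isDef_mem _ _)) <|
    .and (.forall <| .imp (isDef_mem _ _) <| .exists_block <| .and
      (.forall_index fun j => .and (isDef_pair_mem hN _ _ _) (isDef_graphLE hN _ _ _))
      (isDef_graphInfBot hN _ _)) <|
    .forall_block <| .imp ?_ <| .imp ?_ <| .exists <| .and ?_ <| .and ?_ <| .and ?_ ?_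
  · exact .forall_index fun j => .forall <| .forall <| .imp (isDef_pair_mem hN _ _ _) <|
      .exists <| .and (isDef_pair_mem hN _ _ _) (isDef_graphLE hN _ _ _)
  · exact .forall_index fun j => .forall_index fun k => .imp (isDef_const _) <| .forall <|
      .forall <| .forall <| .imp (isDef_pair_mem hN _ _ _) <| .imp (isDef_pair_mem hN _ _ _) <|
      isDef_graphCodisjoint hN _ _ _
  · exact .exists <| isDef_mem _ _
  · exact .forall <| .forall <| .imp (isDef_mem _ _) <| .imp (isDef_mem _ _) <| .exists <|
      .and (isDef_mem _ _) <| .and (isDef_graphLE hN _ _ _) (isDef_graphLE hN _ _ _)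
  · exact .forall <| .imp (isDef_mem _ _) <| .not <| isDef_graphBot hN _ _
  · exact .forall_index fun j => .forall <| .forall <| .imp (isDef_pair_mem hN _ _ _) <|
      isDef_mem _ _

end Order

/-! ### Lattices that belong to `H κ` -/

section Transfer

variable {κ : Cardinal.{u}} {A : ZFSet.{u}}

/-- An element of a lattice in `H κ`, as an element of `H κ`. -/
def Elem.toH (hA : A ∈ H κ) (a : Elem A) : H κ := ⟨a.1, mem_H_of_mem hA a.2⟩

theorem graphLE_opGraph_iff [Lattice (Elem A)] {x y : ZFSet.{u}} :
    GraphLE (opGraph A (· ⊓ ·)) x y ↔ ∃ a b : Elem A, x = a.1 ∧ y = b.1 ∧ a ≤ b := by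
  unfold GraphLE
  rw [mem_opGraph]
  constructor
  · rintro ⟨a, b, h⟩
    obtain ⟨h1, h2⟩ := ZFSet.pair_inj.1 h
    obtain ⟨h3, h4⟩ := ZFSet.pair_inj.1 h1
    exact ⟨a, b, h3, h4, inf_eq_left.1 (Subtype.ext (h2.symm.trans h3))⟩
  · rintro ⟨a, b, rfl, rfl, hab⟩
    exact ⟨a, b, by rw [inf_eq_left.2 hab]⟩

/-- The set of pairs `(d n, x n)`, where `x n ∈ A` and `d n ∈ D`. -/
noncomputable def seqGraph (D : ZFSet.{u}) (d : ℕ → ZFSet.{u}) (x : ℕ → Elem A) : ZFSet.{u} :=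
  ZFSet.sep (fun p => ∃ n, p = ZFSet.pair (d n) (x n).1) (D.prod A)

theorem pair_mem_seqGraph {D : ZFSet.{u}} {d : ℕ → ZFSet.{u}} (hd : ∀ n, d n ∈ D)
    {x : ℕ → Elem A} {i y : ZFSet.{u}} :
    ZFSet.pair i y ∈ seqGraph D d x ↔ ∃ n, i = d n ∧ y = (x n).1 := by
  rw [seqGraph, ZFSet.mem_sep]
  constructor
  · rintro ⟨-, n, h⟩
    exact ⟨n, ZFSet.pair_inj.1 h⟩
  · rintro ⟨n, rfl, rfl⟩
    exact ⟨ZFSet.pair_mem_prod.2 ⟨hd n, (x n).2⟩, n, rfl⟩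

theorem seqGraph_mem_H (hκ : ℵ₀ ≤ κ) (hA : A ∈ H κ) {D : ZFSet.{u}} (hD : D ∈ H κ)
    (d : ℕ → ZFSet.{u}) (x : ℕ → Elem A) : seqGraph D d x ∈ H κ :=
  mem_H_of_subset (prod_mem_H hκ hD hA) (ZFSet.sep_subset)

section Order

variable [Lattice (Elem A)] (hA : A ∈ H κ) {g : H κ}

theorem graphLE_toH_iff (hg : g.1 = opGraph A (· ⊓ ·)) {a b : Elem A} :
    GraphLE g.1 (a.toH hA).1 (b.toH hA).1 ↔ a ≤ b := by
  rw [hg, graphLE_opGraph_iff]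
  constructor
  · rintro ⟨c, d, h1, h2, h⟩
    rwa [show a = c from Subtype.ext h1, show b = d from Subtype.ext h2]
  · exact fun h => ⟨a, b, rfl, rfl, h⟩

theorem exists_toH_of_graphLE (hg : g.1 = opGraph A (· ⊓ ·)) {x y : H κ}
    (h : GraphLE g.1 x.1 y.1) :
    ∃ a b : Elem A, x = a.toH hA ∧ y = b.toH hA ∧ a ≤ b := by
  rw [hg, graphLE_opGraph_iff] at h
  obtain ⟨a, b, h1, h2, h⟩ := h
  exact ⟨a, b, Subtype.ext h1, Subtype.ext h2, h⟩

theorem forall_graphLE_iff (hg : g.1 = opGraph A (· ⊓ ·)) {P : H κ → Prop} :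
    (∀ z : H κ, GraphLE g.1 z.1 z.1 → P z) ↔ ∀ a : Elem A, P (a.toH hA) := by
  refine ⟨fun h a => h _ ((graphLE_toH_iff hA hg).2 le_rfl), fun h z hz => ?_⟩
  obtain ⟨a, -, rfl, -⟩ := exists_toH_of_graphLE hA hg hz
  exact h a

variable [BoundedOrder (Elem A)]

theorem graphBot_toH_iff (hg : g.1 = opGraph A (· ⊓ ·)) {a : Elem A} :
    GraphBot g (a.toH hA) ↔ a = ⊥ := by
  simp only [GraphBot, forall_graphLE_iff hA hg, graphLE_toH_iff hA hg, le_refl, true_and]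
  exact ⟨fun h => le_bot_iff.1 (h ⊥), fun h b => h ▸ bot_le⟩

theorem graphTop_toH_iff (hg : g.1 = opGraph A (· ⊓ ·)) {a : Elem A} :
    GraphTop g (a.toH hA) ↔ a = ⊤ := by
  simp only [GraphTop, forall_graphLE_iff hA hg, graphLE_toH_iff hA hg, le_refl, true_and]
  exact ⟨fun h => top_le_iff.1 (h ⊤), fun h b => h ▸ le_top⟩

theorem graphCodisjoint_toH_iff (hg : g.1 = opGraph A (· ⊓ ·)) {a b : Elem A} :
    GraphCodisjoint g (a.toH hA) (b.toH hA) ↔ a ⊔ b = ⊤ := by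
  constructor
  · intro h
    exact (graphTop_toH_iff hA hg).1 (h ((a ⊔ b).toH hA)
      ((graphLE_toH_iff hA hg).2 le_sup_left) ((graphLE_toH_iff hA hg).2 le_sup_right))
  · intro h z h1 h2
    obtain ⟨-, c, -, rfl, -⟩ := exists_toH_of_graphLE hA hg h1
    rw [graphLE_toH_iff hA hg] at h1 h2
    exact (graphTop_toH_iff hA hg).2 (top_le_iff.1 (h ▸ sup_le h1 h2))

theorem graphInfBot_toH_iff (hg : g.1 = opGraph A (· ⊓ ·)) {ι : Type} [Fintype ι]
    {x : ι → Elem A} :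
    GraphInfBot g (fun j => (x j).toH hA) ↔ Finset.univ.inf x = ⊥ := by
  simp only [GraphInfBot, forall_graphLE_iff hA hg, graphLE_toH_iff hA hg, graphBot_toH_iff hA hg]
  constructor
  · exact fun h => h _ fun j => Finset.inf_le (Finset.mem_univ j)
  · exact fun h a ha => le_bot_iff.1 (h ▸ Finset.le_inf fun j _ => ha j)

end Order

/-- A sequence of `m`-tuples witnessing that a lattice in `H κ` fails `IsMCLattice m` is coded
by sets in `H κ`; here `ℵ₀ < κ` is used. -/
theorem exists_graphBad_of_not_isMCLattice [DistribLattice (Elem A)]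
    [BoundedOrder (Elem A)] (hκ : ℵ₀ < κ) (hA : A ∈ H κ) {g : H κ}
    (hg : g.1 = opGraph A (· ⊓ ·)) {m : ℕ} (h : ¬ IsMCLattice m (Elem A)) :
    ∃ (D : H κ) (s : Fin m → H κ), GraphBad g D s := by
  unfold IsMCLattice at h
  push Not at h
  obtain ⟨u, hu, hbad⟩ := h
  have hD := range_zermelo_mem_H hκ
  have hz : ∀ n, zermelo n ∈ ZFSet.range.{u} zermelo.{u} := fun n => by simp
  refine ⟨⟨_, hD⟩, fun j => ⟨_, seqGraph_mem_H hκ.le hA hD zermelo fun n => u n j⟩,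
    ⟨⟨_, mem_H_of_mem hD (hz 0)⟩, hz 0⟩, ?_, ?_, ?_⟩
  · rintro ⟨i, _⟩ hi
    obtain ⟨n, rfl⟩ := ZFSet.mem_range.1 hi
    exact ⟨⟨_, mem_H_of_mem hD (hz (n + 1))⟩, hz (n + 1), ZFSet.mem_singleton.2 rfl⟩
  · rintro ⟨i, _⟩ hi
    obtain ⟨n, rfl⟩ := ZFSet.mem_range.1 hi
    refine ⟨fun j => (u n j).toH hA, fun j => ⟨(pair_mem_seqGraph hz).2 ⟨n, rfl, rfl⟩,
      (graphLE_toH_iff hA hg).2 le_rfl⟩, (graphInfBot_toH_iff hA hg).2 (hu n)⟩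
  · intro w hw1 hw2
    have hw : ∀ j (i x : H κ), ZFSet.pair i.1 x.1 ∈ (w j).1 →
        ∃ n a, i.1 = zermelo n ∧ x = a.toH hA ∧ u n j ≤ a := by
      intro j i x hx
      obtain ⟨y, hy, hyx⟩ := hw1 j i x hx
      obtain ⟨n, hn, hyn⟩ := (pair_mem_seqGraph hz).1 hy
      obtain ⟨a, b, rfl, rfl, hab⟩ := exists_toH_of_graphLE hA hg hyx
      exact ⟨n, b, hn, rfl, by rwa [← show a = u n j from Subtype.ext hyn]⟩
    have hzH : ∀ n, zermelo n ∈ H κ := fun n => mem_H_of_mem hD (hz n)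
    -- The finite meets of members of `w` form the closed families to which compactness applies.
    obtain ⟨p, hp⟩ : ∃ p : Wallman (Elem A), ∀ k : ℕ × Fin m, ∀ a : Elem A,
        ZFSet.pair (zermelo k.1) a.1 ∈ (w k.2).1 → a ∈ p.1 := by
      by_contra! hne
      obtain ⟨x, hx, t, ht⟩ := exists_finset_inf_eq_bot
        (fun k : ℕ × Fin m => {a : Elem A | ∃ t : Finset (Elem A),
          (∀ b ∈ t, ZFSet.pair (zermelo k.1) b.1 ∈ (w k.2).1) ∧ t.inf id = a})
        (fun k => ⟨∅, by simp, rfl⟩) (by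
          classical
          rintro k _ ⟨t, ht, rfl⟩ _ ⟨t', ht', rfl⟩
          refine ⟨t ∪ t', fun b hb => ?_, Finset.inf_union⟩
          exact (Finset.mem_union.1 hb).elim (ht b) (ht' b)) (by
          intro p
          obtain ⟨k, a, ha, hap⟩ := hne p
          exact ⟨k, a, ⟨{a}, by simpa using ha, by simp⟩, hap⟩)
      refine hbad (fun i j => x (i, j)) (fun i j => ?_) (fun i j k hjk => ?_) t ht
      · obtain ⟨t, ht, e⟩ := hx (i, j)
        rw [← e]
        refine Finset.le_inf fun b hb => ?_
        obtain ⟨n, a, hn, hba, hna⟩ := hw j ⟨_, hzH i⟩ (b.toH hA) (ht b hb)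
        rw [zermelo_injective hn, show b = a from Subtype.ext (congrArg (fun y : H κ => y.1) hba)]
        exact hna
      · obtain ⟨t, ht, e⟩ := hx (i, j)
        obtain ⟨t', ht', e'⟩ := hx (i, k)
        rw [← e, ← e']
        refine Finset.inf_induction (p := fun a => a ⊔ t'.inf id = ⊤) (by simp)
          (fun a ha b hb => by rw [sup_inf_right, ha, hb, inf_top_eq]) fun a ha => ?_
        rw [sup_comm]
        refine Finset.inf_induction (p := fun b => b ⊔ id a = ⊤) (by simp)
          (fun a ha b hb => by rw [sup_inf_right, ha, hb, inf_top_eq]) fun b hb => ?_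
        rw [sup_comm]
        exact (graphCodisjoint_toH_iff hA hg).1
          (hw2 j k hjk ⟨_, hzH i⟩ (a.toH hA) (b.toH hA) (ht a ha) (ht' b hb))
    have hmem : ∀ x : H κ, x.1 ∈ ZFSet.sep (fun x => ∃ a ∈ p.1, x = a.1) A ↔
        ∃ a ∈ p.1, x = a.toH hA := by
      intro x
      rw [ZFSet.mem_sep]
      constructor
      · rintro ⟨-, a, ha, h⟩
        exact ⟨a, ha, Subtype.ext h⟩
      · rintro ⟨a, ha, rfl⟩
        exact ⟨a.2, a, ha, rfl⟩
    refine ⟨⟨ZFSet.sep (fun x => ∃ a ∈ p.1, x = a.1) A, mem_H_of_subset hA (ZFSet.sep_subset)⟩,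
      ?_⟩
    simp only [hmem]
    refine ⟨⟨_, ⊤, p.2.prop.top_mem, rfl⟩, ?_, ?_, ?_⟩
    · rintro _ _ ⟨a, ha, rfl⟩ ⟨b, hb, rfl⟩
      exact ⟨_, ⟨a ⊓ b, p.2.prop.inf_mem a ha b hb, rfl⟩,
        (graphLE_toH_iff hA hg).2 inf_le_left, (graphLE_toH_iff hA hg).2 inf_le_right⟩
    · rintro _ ⟨a, ha, rfl⟩ h
      rw [graphBot_toH_iff hA hg] at h
      exact p.2.prop.bot_notMem (h ▸ ha)
    · intro j i x hx
      obtain ⟨n, a, hi, rfl, -⟩ := hw j i x hx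
      exact ⟨a, hp (n, j) a (hi ▸ hx), rfl⟩

end Transfer

/-! ### The trace of a lattice on an elementary submodel -/

section Trace

variable {κ : Cardinal.{u}} {M : Set ZFSet.{u}} (hM : IsElemSubmodel M (H κ)) {A : ZFSet.{u}}
  [DistribLattice (Elem A)] [BoundedOrder (Elem A)] (hA : latticeCode A ∈ M)

theorem traceLattice.coe_finset_inf {ι : Type*} (s : Finset ι) (x : ι → traceLattice A hM hA) :
    ((s.inf x : traceLattice A hM hA) : Elem A) = s.inf fun k => (x k : Elem A) :=
  Finset.apply_inf_eq_inf_comp (fun a : traceLattice A hM hA => (a : Elem A))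
    (fun _ _ => rfl) rfl

/-- The trace of the lattice is separative, by elementarity. -/
theorem traceLattice.isSeparative (hsep : IsSeparative (Elem A)) :
    IsSeparative (traceLattice A hM hA) := by
  intro a b hab
  have hAH := hM.sub (hM.of_pair_mem hA).1
  have hgM := (hM.of_pair_mem (hM.of_pair_mem (hM.of_pair_mem hA).2).2).1
  set g : H κ := ⟨_, hM.sub hgM⟩
  have hg : g.1 = opGraph A (· ⊓ ·) := rfl
  obtain ⟨c, hc, hca, hcb⟩ := hsep a b hab
  have hN : ∀ x ∈ H κ, ∀ y ∈ x, y ∈ H κ := fun _ hx _ hy => mem_H_of_mem hx hy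
  obtain ⟨c', hcM, hc1, hc2, hc3⟩ := hM.exists_of_isDef_single
    (P := fun (v : Fin 3 → H κ) c => GraphLE (v 0).1 c.1 (v 1).1 ∧ ¬ GraphBot (v 0) c ∧
      ∀ z : H κ, GraphLE (v 0).1 z.1 c.1 → GraphLE (v 0).1 z.1 (v 2).1 → GraphBot (v 0) z)
    (.and (isDef_graphLE hN _ _ _) <| .and (.not <| isDef_graphBot hN _ _) <| .forall <|
      .imp (isDef_graphLE hN _ _ _) <| .imp (isDef_graphLE hN _ _ _) (isDef_graphBot hN _ _))
    ![g, a.1.toH hAH, b.1.toH hAH] (by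
      intro i
      fin_cases i
      exacts [hgM, a.2, b.2])
    ⟨c.toH hAH, (graphLE_toH_iff hAH hg).2 hca, fun h => hc ((graphBot_toH_iff hAH hg).1 h), by
      intro z h1 h2
      obtain ⟨d, -, rfl, -⟩ := exists_toH_of_graphLE hAH hg h1
      exact (graphBot_toH_iff hAH hg).2 (le_bot_iff.1 (hcb ▸ le_inf
        ((graphLE_toH_iff hAH hg).1 h1) ((graphLE_toH_iff hAH hg).1 h2)))⟩
  obtain ⟨d, -, rfl, -⟩ := exists_toH_of_graphLE hAH hg hc1
  refine ⟨⟨d, hcM⟩, fun h => hc2 ((graphBot_toH_iff hAH hg).2 (congrArg Subtype.val h)),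
    (graphLE_toH_iff hAH hg).1 hc1, Subtype.ext ?_⟩
  exact (graphBot_toH_iff hAH hg).1 (hc3 ((d ⊓ b.1).toH hAH)
    ((graphLE_toH_iff hAH hg).2 inf_le_left) ((graphLE_toH_iff hAH hg).2 inf_le_right))

/-- A sequence of tuples from the trace has a refinement in the whole lattice, of which only a
finite part matters. By elementarity that finite part can be found in the trace. -/
theorem traceLattice.isMCLattice_of {m : ℕ} (h : IsMCLattice m (Elem A)) :
    IsMCLattice m (traceLattice A hM hA) := by
  intro u hu
  have hAH := hM.sub (hM.of_pair_mem hA).1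
  have hgM := (hM.of_pair_mem (hM.of_pair_mem (hM.of_pair_mem hA).2).2).1
  set g : H κ := ⟨_, hM.sub hgM⟩
  have hg : g.1 = opGraph A (· ⊓ ·) := rfl
  have hN : ∀ x ∈ H κ, ∀ y ∈ x, y ∈ H κ := fun _ hx _ hy => mem_H_of_mem hx hy
  obtain ⟨v, hv1, hv2, s, hs⟩ := h (fun i j => (u i j).1) fun i => by
    rw [← traceLattice.coe_finset_inf, hu]; rfl
  obtain ⟨n, hn⟩ : ∃ n, ∀ k ∈ s, k.1 < n :=
    ⟨s.sup Prod.fst + 1, fun k hk => Nat.lt_succ_of_le (Finset.le_sup (f := Prod.fst) hk)⟩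
  obtain ⟨x, hxM, hx1, hx2, hx3⟩ := hM.exists_of_isDef
    (P := fun (a : Option (Fin n × Fin m) → H κ) (x : Fin n × Fin m → H κ) =>
      (∀ k, GraphLE (a none).1 (a (some k)).1 (x k).1) ∧
      (∀ i j k, j ≠ k → GraphCodisjoint (a none) (x (i, j)) (x (i, k))) ∧
      GraphInfBot (a none) fun k => x k)
    (.and (.forall_index fun k => isDef_graphLE hN _ _ _) <| .and
      (.forall_index fun i => .forall_index fun j => .forall_index fun k =>
        .imp (isDef_const _) (isDef_graphCodisjoint hN _ _ _)) (isDef_graphInfBot hN _ _))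
    (fun o => o.elim g fun k => (u k.1 k.2).1.toH hAH) (by
      rintro (_ | k)
      exacts [hgM, (u k.1 k.2).2])
    ⟨fun k => (v k.1 k.2).toH hAH, fun k => (graphLE_toH_iff hAH hg).2 (hv1 _ _),
      fun i j k hjk => (graphCodisjoint_toH_iff hAH hg).2 (hv2 i hjk), by
      refine (graphInfBot_toH_iff hAH hg).2 (le_bot_iff.1 (hs ▸ Finset.le_inf fun k hk => ?_))
      exact Finset.inf_le (f := fun k : Fin n × Fin m => v k.1 k.2)
        (Finset.mem_univ (⟨k.1, hn k hk⟩, k.2))⟩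
  have hx : ∀ k, ∃ a : traceLattice A hM hA, x k = a.1.toH hAH := by
    intro k
    obtain ⟨-, b, -, e, -⟩ := exists_toH_of_graphLE hAH hg (hx1 k)
    exact ⟨⟨b, show b.1 ∈ M from (congrArg Subtype.val e) ▸ hxM k⟩, e⟩
  choose y hy using hx
  obtain rfl : x = fun k => (y k).1.toH hAH := funext hy
  refine ⟨fun i j => if hi : i < n then y (⟨i, hi⟩, j) else ⊤, fun i j => ?_,
    fun i j k hjk => ?_, Finset.univ.image fun k : Fin n × Fin m => (k.1.1, k.2), ?_⟩
  · dsimp only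
    split_ifs with hi
    · exact (graphLE_toH_iff hAH hg).1 (hx1 (⟨i, hi⟩, j))
    · exact le_top
  · dsimp only
    split_ifs with hi
    · exact Subtype.ext ((graphCodisjoint_toH_iff hAH hg).1 (hx2 ⟨i, hi⟩ j k hjk))
    · simp
  · refine Subtype.ext ?_
    rw [Finset.inf_image, traceLattice.coe_finset_inf]
    refine Eq.trans ?_ ((graphInfBot_toH_iff hAH hg).1 hx3)
    refine Finset.inf_congr rfl fun k _ => ?_
    simp

/-- If the whole lattice has a sequence without refinement, then by elementarity such a sequence
is coded in `M`. The members of the code that lie in `M` contain a sequence of tuples from the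
trace, and a refinement of it in the trace would refine the coded sequence. -/
theorem traceLattice.isMCLattice_iff (hκ : ℵ₀ < κ) (m : ℕ) :
    IsMCLattice m (Elem A) ↔ IsMCLattice m (traceLattice A hM hA) := by
  refine ⟨traceLattice.isMCLattice_of hM hA, fun h => ?_⟩
  by_contra hbad
  have hAH := hM.sub (hM.of_pair_mem hA).1
  have hgM := (hM.of_pair_mem (hM.of_pair_mem (hM.of_pair_mem hA).2).2).1
  set g : H κ := ⟨_, hM.sub hgM⟩
  have hg : g.1 = opGraph A (· ⊓ ·) := rfl
  have hN : ∀ x ∈ H κ, ∀ y ∈ x, y ∈ H κ := fun _ hx _ hy => mem_H_of_mem hx hy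
  obtain ⟨D₀, s₀, hDs⟩ := exists_graphBad_of_not_isMCLattice hκ hAH hg hbad
  obtain ⟨x, hxM, hx⟩ := hM.exists_of_isDef
    (P := fun (a : Unit → H κ) (x : Option (Fin m) → H κ) =>
      GraphBad (a ()) (x none) fun j => x (some j))
    (isDef_graphBad hN _ _ _) (fun _ => g) (fun _ => hgM) ⟨fun o => o.elim D₀ s₀, hDs⟩
  obtain ⟨D, hD⟩ : ∃ D, D = x none := ⟨_, rfl⟩
  obtain ⟨s, hs⟩ : ∃ s : Fin m → H κ, s = fun j => x (some j) := ⟨_, rfl⟩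
  have hDM : D.1 ∈ M := hD ▸ hxM none
  have hsM : ∀ j, (s j).1 ∈ M := fun j => hs ▸ hxM (some j)
  rw [← hD, ← hs] at hx
  obtain ⟨hne, hsucc, htuple, hw⟩ := hx
  -- An infinite sequence of indices in `D ∩ M`, increasing with respect to membership.
  obtain ⟨i₀, hi₀M, hi₀⟩ := hM.exists_of_isDef_single
    (P := fun (a : Unit → H κ) (i : H κ) => i.1 ∈ (a ()).1) (isDef_mem _ _) (fun _ => D)
    (fun _ => hDM) hne
  have hstep : ∀ i : {i : H κ // i.1 ∈ M ∧ i.1 ∈ D.1},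
      ∃ k : {i : H κ // i.1 ∈ M ∧ i.1 ∈ D.1}, i.1.1 ∈ k.1.1 := by
    rintro ⟨i, hiM, hi⟩
    obtain ⟨k, hkM, hk1, hk2⟩ := hM.exists_of_isDef_single
      (P := fun (a : Bool → H κ) (k : H κ) => k.1 ∈ (a true).1 ∧ (a false).1 ∈ k.1)
      (.and (isDef_mem _ _) (isDef_mem _ _)) (fun b => cond b D i)
      (by rintro (_ | _); exacts [hiM, hDM]) (hsucc i hi)
    exact ⟨⟨k, hkM, hk1⟩, hk2⟩
  choose next hnext using hstep
  obtain ⟨d, hd⟩ : ∃ d : ℕ → {i : H κ // i.1 ∈ M ∧ i.1 ∈ D.1},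
      ∀ n, (d n).1.1 ∈ (d (n + 1)).1.1 :=
    ⟨fun n => next^[n] ⟨i₀, hi₀M, hi₀⟩, fun n => by
      simp only [Function.iterate_succ_apply']; exact hnext _⟩
  have hdinj : Function.Injective fun n => (d n).1.1 := by
    have : StrictMono fun n => ((d n).1.1).rank := strictMono_nat_of_lt_succ fun n =>
      ZFSet.rank_lt_of_mem (hd n)
    exact fun a b hab => this.injective (congrArg ZFSet.rank hab)
  have hu : ∀ n, ∃ u : Fin m → traceLattice A hM hA,
      (∀ j, ZFSet.pair (d n).1.1 (u j).1.1 ∈ (s j).1) ∧ Finset.univ.inf u = ⊥ := by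
    intro n
    obtain ⟨x, hxM, hx1, hx2⟩ := hM.exists_of_isDef
      (P := fun (a : Fin m ⊕ Bool → H κ) (x : Fin m → H κ) =>
        (∀ j, ZFSet.pair (a (Sum.inr true)).1 (x j).1 ∈ (a (Sum.inl j)).1 ∧
          GraphLE (a (Sum.inr false)).1 (x j).1 (x j).1) ∧ GraphInfBot (a (Sum.inr false)) x)
      (.and (.forall_index fun j => .and (isDef_pair_mem hN _ _ _) (isDef_graphLE hN _ _ _))
        (isDef_graphInfBot hN _ _))
      (Sum.elim s fun b => cond b (d n).1 g)
      (by rintro (j | _ | _); exacts [hsM j, hgM, (d n).2.1]) (htuple _ (d n).2.2)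
    have hx : ∀ j, ∃ a : traceLattice A hM hA, x j = a.1.toH hAH := by
      intro j
      obtain ⟨a, -, e, -⟩ := exists_toH_of_graphLE hAH hg (hx1 j).2
      exact ⟨⟨a, show a.1 ∈ M from (congrArg Subtype.val e) ▸ hxM j⟩, e⟩
    choose u hu using hx
    obtain rfl : x = fun j => (u j).1.toH hAH := funext hu
    refine ⟨u, fun j => (hx1 j).1, Subtype.ext ?_⟩
    rw [traceLattice.coe_finset_inf]
    exact (graphInfBot_toH_iff hAH hg).1 hx2
  choose u hu1 hu2 using hu
  obtain ⟨v, hv1, hv2, t, ht⟩ := h u hu2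
  have hdD : ∀ n, (d n).1.1 ∈ D.1 := fun n => (d n).2.2
  obtain ⟨F, ⟨x₀, hx₀⟩, hF1, hF2, hF3⟩ := hw
    (fun j => ⟨_, seqGraph_mem_H hκ.le hAH D.2 (fun n => (d n).1.1) fun n => (v n j).1⟩) (by
      rintro j ⟨_, _⟩ ⟨_, _⟩ hx
      obtain ⟨n, rfl, rfl⟩ := (pair_mem_seqGraph hdD).1 hx
      exact ⟨(u n j).1.toH hAH, hu1 n j, (graphLE_toH_iff hAH hg).2 (hv1 n j)⟩) (by
      rintro j k hjk ⟨_, _⟩ ⟨_, _⟩ ⟨_, _⟩ hx hy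
      obtain ⟨n, rfl, rfl⟩ := (pair_mem_seqGraph hdD).1 hx
      obtain ⟨n', hn', rfl⟩ := (pair_mem_seqGraph hdD).1 hy
      obtain rfl := hdinj hn'
      exact (graphCodisjoint_toH_iff hAH hg).2 (congrArg Subtype.val (hv2 n hjk)))
  have hvF : ∀ k : ℕ × Fin m, ((v k.1 k.2).1.toH hAH).1 ∈ F.1 := fun k =>
    hF3 k.2 (d k.1).1 _ ((pair_mem_seqGraph hdD).2 ⟨k.1, rfl, rfl⟩)
  -- Finitely many members of the filter base `F` have a common lower bound in `F`.
  have hlow : ∃ z : H κ, z.1 ∈ F.1 ∧ GraphLE g.1 z.1 z.1 ∧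
      ∀ k ∈ t, GraphLE g.1 z.1 ((v k.1 k.2).1.toH hAH).1 := by
    have htrans : ∀ x y z : H κ, GraphLE g.1 x.1 y.1 → GraphLE g.1 y.1 z.1 →
        GraphLE g.1 x.1 z.1 := by
      intro x y z hxy hyz
      obtain ⟨a, b, rfl, rfl, hab⟩ := exists_toH_of_graphLE hAH hg hxy
      obtain ⟨-, c, -, rfl, -⟩ := exists_toH_of_graphLE hAH hg hyz
      exact (graphLE_toH_iff hAH hg).2 (hab.trans ((graphLE_toH_iff hAH hg).1 hyz))
    clear ht
    induction t using Finset.induction_on with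
    | empty =>
      obtain ⟨z, hz, hzx, -⟩ := hF1 x₀ x₀ hx₀ hx₀
      obtain ⟨a, -, rfl, -⟩ := exists_toH_of_graphLE hAH hg hzx
      exact ⟨_, hz, (graphLE_toH_iff hAH hg).2 le_rfl, by simp⟩
    | insert k t _ ih =>
      obtain ⟨z, hz, -, hzt⟩ := ih
      obtain ⟨y, hy, hyz, hyk⟩ := hF1 z _ hz (hvF k)
      refine ⟨y, hy, ?_, ?_⟩
      · obtain ⟨a, -, rfl, -⟩ := exists_toH_of_graphLE hAH hg hyz
        exact (graphLE_toH_iff hAH hg).2 le_rfl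
      · intro l hl
        rcases Finset.mem_insert.1 hl with rfl | hl
        · exact hyk
        · exact htrans _ _ _ hyz (hzt l hl)
  obtain ⟨z, hz, hzz, hzt⟩ := hlow
  obtain ⟨a, -, rfl, -⟩ := exists_toH_of_graphLE hAH hg hzz
  refine hF2 _ hz ((graphBot_toH_iff hAH hg).2 (le_bot_iff.1 ?_))
  have hbot := congrArg Subtype.val ht
  rw [traceLattice.coe_finset_inf] at hbot
  exact (Finset.le_inf fun k hk => (graphLE_toH_iff hAH hg).1 (hzt k hk)).trans hbot.le

end Trace

end MC

theorem mainTheorem4 (κ : Cardinal.{u}) (hκ : κ.IsRegular) (hκ₀ : ℵ₀ < κ)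
    (M : Set ZFSet.{u}) (hM : MC.IsElemSubmodel M (MC.H κ))
    (Kstar : ZFSet.{u}) [DistribLattice (MC.Elem Kstar)] [BoundedOrder (MC.Elem Kstar)]
    (hsep : MC.IsSeparative (MC.Elem Kstar)) (hK : MC.latticeCode Kstar ∈ M)
    (m : ℕ) (hm : 2 ≤ m) :
    MC.IsMCSpace m (MC.Wallman (MC.Elem Kstar)) ↔
      MC.IsMCSpace m (MC.Wallman (MC.traceLattice Kstar hM hK)) := by
  rw [MC.isMCSpace_wallman_iff hsep, MC.traceLattice.isMCLattice_iff hM hK hκ₀]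
  exact (MC.isMCSpace_wallman_iff (L := MC.traceLattice Kstar hM hK)
    (MC.traceLattice.isSeparative hM hK hsep) m).symm
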